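/- Let $(M,g)$ and $(N,h)$ be smooth finite-dimensional Riemannian manifolds (without boundary), with Levi-Civita connections $\nabla$ and $\nabla^N$, let $m=\dim M$, and let $\varphi:M\to N$ be a smooth map. Let $\overline{\nabla}$ be the connection on $\varphi^{-1}TN$ induced by $\nabla^N$, let $R^N(U,V)=\nabla^N_U\nabla^N_V-\nabla^N_V\nabla^N_U-\nabla^N_{[U,V]}$ be the curvature tensor of $N$, and let $\{e_i\}_{i=1}^m$ denote a local orthonormal frame of $(M,g)$. Define the tension field, the rough Laplacian and the Jacobi operator on sections $V$ of $\varphi^{-1}TN$, and the tritension field by $$\tau(\varphi)=\sum_{i=1}^m\{\overline{\nabla}_{e_i}(d\varphi(e_i))-d\varphi(\nabla_{e_i}e_i)\},\qquad \overline{\Delta}V=-\sum_{i=1}^m\{\overline{\nabla}_{e_i}\overline{\nabla}_{e_i}V-\overline{\nabla}_{\nabla_{e_i}e_i}V\},$$ $$\mathcal{J}(V)=\overline{\Delta}V-\sum_{i=1}^mR^N(V,d\varphi(e_i))d\varphi(e_i),\qquad \tau_3(\varphi)=\mathcal{J}(\overline{\Delta}\tau(\varphi))-\sum_{i=1}^mR^N(\overline{\nabla}_{e_i}\tau(\varphi),\tau(\varphi))d\varphi(e_i);$$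 these do not depend on the choice of the frame. Assume that $(N,h)$ has constant sectional curvature $c\in\mathbb{R}$ and that $\varphi$ is an isometric immersion, i.e. $h(d\varphi(u),d\varphi(v))=g(u,v)$ for all $x\in M$ and $u,v\in T_xM$. Then, at every point of $M$ and for every orthonormal basis $\{e_j\}$ of the tangent space there, $$\tau_3(\varphi)=\overline{\Delta}^2\tau(\varphi)-\sum_{j=1}^mR^N(\overline{\Delta}\tau(\varphi),d\varphi(e_j))d\varphi(e_j)-c\,h(\tau(\varphi),\tau(\varphi))\,\tau(\varphi).$$ -/

import Mathlib

open Bundle Manifold VectorField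
open scoped ContDiff

namespace RiemGeom

set_option linter.unusedSectionVars false

noncomputable section

/-! ### The Levi-Civita connection -/

section LeviCivita

variable {E : Type*} [NormedAddCommGroup E] [NormedSpace ℝ E] [FiniteDimensional ℝ E]
  {H : Type*} [TopologicalSpace H] (I : ModelWithCorners ℝ E H)
  {M : Type*} [TopologicalSpace M] [ChartedSpace H M]

instance tangentSpace_finiteDimensional (x : M) : FiniteDimensional ℝ (TangentSpace I x) :=
  inferInstanceAs (FiniteDimensional ℝ E)

variable [IsManifold I ∞ M] [RiemannianBundle (fun x : M ↦ TangentSpace I x)]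

/-- The right-hand side of the Koszul formula for `⟨∇_X Y, Z⟩`. -/
def koszul (X Y Z : Π x : M, TangentSpace I x) (x : M) : ℝ :=
  (mvfderiv I (fun z ↦ inner ℝ (Y z) (Z z)) x (X x)
    + mvfderiv I (fun z ↦ inner ℝ (Z z) (X z)) x (Y x)
    - mvfderiv I (fun z ↦ inner ℝ (X z) (Y z)) x (Z x)
    + inner ℝ (mlieBracket I X Y x) (Z x)
    - inner ℝ (mlieBracket I X Z x) (Y x)
    - inner ℝ (mlieBracket I Y Z x) (X x)) / 2

variable [IsContMDiffRiemannianBundle I ∞ E (fun x : M ↦ TangentSpace I x)]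
  {X Y Z : Π x : M, TangentSpace I x} {x : M}

variable {I} in
theorem mdiffAt_inner (hX : MDiffAt (T% X) x) (hY : MDiffAt (T% Y) x) :
    MDiffAt (fun z ↦ inner ℝ (X z) (Y z)) x :=
  MDifferentiableAt.inner_bundle (F := E) (E := fun x : M ↦ TangentSpace I x) hX hY

theorem koszul_tensorial_left (hY : MDiffAt (T% Y) x) (hZ : MDiffAt (T% Z) x) :
    TensorialAt I E (fun X ↦ koszul I X Y Z x) x where
  smul {f X} hf hX := by
    have h1 := mvfderiv_fun_mul hf (mdiffAt_inner hZ hX)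
    have h2 := mvfderiv_fun_mul hf (mdiffAt_inner hX hY)
    simp [koszul, inner_smul_left, inner_smul_right, mlieBracket_smul_left hf hX, h1, h2,
      inner_add_left]
    rw [real_inner_comm (X x) (Z x)]
    ring
  add {X X'} hX hX' := by
    have h1 := mvfderiv_fun_add (mdiffAt_inner hZ hX) (mdiffAt_inner hZ hX')
    have h2 := mvfderiv_fun_add (mdiffAt_inner hX hY) (mdiffAt_inner hX' hY)
    simp [koszul, mlieBracket_add_left hX hX', h1, h2, inner_add_left, inner_add_right]
    ring

theorem koszul_tensorial_right (hX : MDiffAt (T% X) x) (hY : MDiffAt (T% Y) x) :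
    TensorialAt I E (fun Z ↦ koszul I X Y Z x) x where
  smul {f Z} hf hZ := by
    have h1 := mvfderiv_fun_mul hf (mdiffAt_inner hY hZ)
    have h2 := mvfderiv_fun_mul hf (mdiffAt_inner hZ hX)
    simp [koszul, inner_smul_left, inner_smul_right, mlieBracket_smul_right hf hZ, h1, h2,
      inner_add_left]
    rw [real_inner_comm (Y x) (Z x)]
    ring
  add {Z Z'} hZ hZ' := by
    have h1 := mvfderiv_fun_add (mdiffAt_inner hY hZ) (mdiffAt_inner hY hZ')
    have h2 := mvfderiv_fun_add (mdiffAt_inner hZ hX) (mdiffAt_inner hZ' hX)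
    simp [koszul, mlieBracket_add_right hZ hZ', h1, h2, inner_add_left, inner_add_right]
    ring

theorem koszul_add (hX : MDiffAt (T% X) x) {Y Y' : Π x : M, TangentSpace I x}
    (hY : MDiffAt (T% Y) x)  (hY' : MDiffAt (T% Y') x) (hZ : MDiffAt (T% Z) x) :
    koszul I X (Y + Y') Z x = koszul I X Y Z x + koszul I X Y' Z x := by
  have h1 := mvfderiv_fun_add (mdiffAt_inner hY hZ) (mdiffAt_inner hY' hZ)
  have h2 := mvfderiv_fun_add (mdiffAt_inner hX hY) (mdiffAt_inner hX hY')
  simp [koszul, mlieBracket_add_right hY hY', mlieBracket_add_left hY hY', h1, h2,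
    inner_add_left, inner_add_right]
  ring

theorem koszul_leibniz {f : M → ℝ} (hf : MDiffAt f x) (hX : MDiffAt (T% X) x)
    (hY : MDiffAt (T% Y) x) (hZ : MDiffAt (T% Z) x) :
    koszul I X (f • Y) Z x =
      f x * koszul I X Y Z x + mvfderiv I f x (X x) * inner ℝ (Y x) (Z x) := by
  have h1 := mvfderiv_fun_mul hf (mdiffAt_inner hY hZ)
  have h2 := mvfderiv_fun_mul hf (mdiffAt_inner hX hY)
  simp [koszul, inner_smul_left, inner_smul_right, mlieBracket_smul_right hf hY,
    mlieBracket_smul_left hf hY, h1, h2, inner_add_left]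
  rw [real_inner_comm (Y x) (X x)]
  ring

open Classical in
/-- `leviCivitaFun I Y x v` is `(∇_v Y)(x)`: the tangent vector whose inner product with `z` is given
by the Koszul formula, for any differentiable fields that extend `v` and `z`. Where `Y` is not
differentiable the value is `0`. -/
def leviCivitaFun (Y : Π x : M, TangentSpace I x) (x : M) :
    TangentSpace I x →L[ℝ] TangentSpace I x :=
  if hY : MDiffAt (T% Y) x then
    ∑ k, ((TensorialAt.mkHom₂ (fun X Z ↦ koszul I X Y Z x) x
        (fun _ hZ ↦ koszul_tensorial_left I hY hZ)
        (fun _ hX ↦ koszul_tensorial_right I hX hY)).flip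
          (stdOrthonormalBasis ℝ (TangentSpace I x) k)).smulRight
            (stdOrthonormalBasis ℝ (TangentSpace I x) k)
  else 0

theorem inner_leviCivitaFun (hX : MDiffAt (T% X) x) (hY : MDiffAt (T% Y) x)
    (hZ : MDiffAt (T% Z) x) :
    inner ℝ (leviCivitaFun I Y x (X x)) (Z x) = koszul I X Y Z x := by
  rw [← TensorialAt.mkHom₂_apply (Φ := fun X Z ↦ koszul I X Y Z x)
    (fun _ hZ ↦ koszul_tensorial_left I hY hZ)
    (fun _ hX ↦ koszul_tensorial_right I hX hY) hX hZ]
  rw [leviCivitaFun, dif_pos hY]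
  generalize TensorialAt.mkHom₂ (fun X Z ↦ koszul I X Y Z x) x
    (fun _ hZ ↦ koszul_tensorial_left I hY hZ)
    (fun _ hX ↦ koszul_tensorial_right I hX hY) = A
  conv_rhs => rw [← (stdOrthonormalBasis ℝ (TangentSpace I x)).sum_repr' (Z x)]
  simp [sum_inner, inner_smul_left, mul_comm]

theorem ext_inner_field {v w : TangentSpace I x}
    (h : ∀ Z : Π x : M, TangentSpace I x, MDiffAt (T% Z) x → inner ℝ v (Z x) = inner ℝ w (Z x)) :
    v = w := by
  refine ext_inner_right ℝ fun z ↦ ?_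
  simpa using h (FiberBundle.extend E z) (FiberBundle.mdifferentiableAt_extend ..)

variable (M) in
/-- The Levi-Civita connection: `leviCivita I M Y x v` is `(∇_v Y)(x)`. -/
def leviCivita : CovariantDerivative I E (fun x : M ↦ TangentSpace I x) where
  toFun := leviCivitaFun I
  isCovariantDerivativeOnUniv :=
    { add := by
        intro Y Y' x hY hY' _
        ext1 v
        refine ext_inner_field I fun Z hZ ↦ ?_
        have hX := FiberBundle.mdifferentiableAt_extend I E v
        have hYY := mdifferentiableAt_add_section hY hY'
        have := inner_leviCivitaFun I hX hYY hZ
        simpa [inner_add_left, koszul_add I hX hY hY' hZ, ← inner_leviCivitaFun I hX hY hZ,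
          ← inner_leviCivitaFun I hX hY' hZ] using this
      leibniz := by
        intro Y f x hY hf _
        ext1 v
        refine ext_inner_field I fun Z hZ ↦ ?_
        have hX := FiberBundle.mdifferentiableAt_extend I E v
        have hYY := hf.smul_section hY
        have := inner_leviCivitaFun I hX hYY hZ
        simpa [inner_add_left, inner_smul_left, koszul_leibniz I hf hX hY hZ,
          ← inner_leviCivitaFun I hX hY hZ] using this }

theorem torsion_leviCivita : (leviCivita I M).torsion = 0 := by
  rw [CovariantDerivative.torsion_eq_zero_iff]
  intro X Y x hX hY
  refine ext_inner_field I fun Z hZ ↦ ?_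
  rw [inner_sub_left]
  erw [inner_leviCivitaFun I hX hY hZ, inner_leviCivitaFun I hY hX hZ]
  simp only [koszul, real_inner_comm]
  rw [mlieBracket_swap_apply (V := Y) (W := X), inner_neg_right]
  ring

theorem isMetricCompatible_leviCivita : CovariantDerivative.IsMetricCompatible (F := E)
    (V := fun x : M ↦ TangentSpace I x) (leviCivita I M) := by
  rw [CovariantDerivative.isMetricCompatible_iff]
  intro x X Y Z hX hY hZ
  dsimp only
  rw [real_inner_comm _ (Y x)]
  erw [inner_leviCivitaFun I hX hY hZ, inner_leviCivitaFun I hX hZ hY]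
  simp only [koszul, real_inner_comm]
  rw [mlieBracket_swap_apply (V := Z) (W := Y), inner_neg_right]
  ring

end LeviCivita

/-! ### Curvature -/

section Curvature

variable {F : Type*} [NormedAddCommGroup F] [NormedSpace ℝ F] [FiniteDimensional ℝ F]
  {G : Type*} [TopologicalSpace G] (J : ModelWithCorners ℝ F G)
  {N : Type*} [TopologicalSpace N] [ChartedSpace G N] [IsManifold J ∞ N]
  [RiemannianBundle (fun y : N ↦ TangentSpace J y)]
  [IsContMDiffRiemannianBundle J ∞ F (fun y : N ↦ TangentSpace J y)]

/-- The curvature tensor `R(u, v)w = ∇_U ∇_V W - ∇_V ∇_U W - ∇_[U, V] W` at `y`, where `U`, `V`, `W`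
are the extensions of `u`, `v`, `w` with constant components in the chart at `y`. -/
def curvature {y : N} (u v w : TangentSpace J y) : TangentSpace J y :=
  let U : Π z : N, TangentSpace J z := FiberBundle.extend F u
  let V : Π z : N, TangentSpace J z := FiberBundle.extend F v
  let W : Π z : N, TangentSpace J z := FiberBundle.extend F w
  leviCivita J N (fun z ↦ leviCivita J N W z (V z)) y u
    - leviCivita J N (fun z ↦ leviCivita J N W z (U z)) y v
    - leviCivita J N W y (mlieBracket J U V y)

/-- The sectional curvature of the plane spanned by two linearly independent tangent vectors. -/
def sectionalCurvature {y : N} (u v : TangentSpace J y) : ℝ :=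
  inner ℝ (curvature J u v v) u / (inner ℝ u u * inner ℝ v v - inner ℝ u v ^ 2)

variable (N) in
/-- `N` has constant (sectional) curvature `c`. -/
def HasConstantCurvature (c : ℝ) : Prop :=
  ∀ (y : N) (u v : TangentSpace J y), LinearIndependent ℝ ![u, v] → sectionalCurvature J u v = c

end Curvature

/-! ### Smooth maps between Riemannian manifolds -/

section Maps

variable {E : Type*} [NormedAddCommGroup E] [NormedSpace ℝ E] [FiniteDimensional ℝ E]
  {H : Type*} [TopologicalSpace H] (I : ModelWithCorners ℝ E H)
  {M : Type*} [TopologicalSpace M] [ChartedSpace H M] [IsManifold I ∞ M]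
  [RiemannianBundle (fun x : M ↦ TangentSpace I x)]
  [IsContMDiffRiemannianBundle I ∞ E (fun x : M ↦ TangentSpace I x)]
  {F : Type*} [NormedAddCommGroup F] [NormedSpace ℝ F] [FiniteDimensional ℝ F]
  {G : Type*} [TopologicalSpace G] (J : ModelWithCorners ℝ F G)
  {N : Type*} [TopologicalSpace N] [ChartedSpace G N] [IsManifold J ∞ N]
  [RiemannianBundle (fun y : N ↦ TangentSpace J y)]
  [IsContMDiffRiemannianBundle J ∞ F (fun y : N ↦ TangentSpace J y)]

/-- A smooth map whose differential preserves inner products (hence is injective). -/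
structure IsIsometricImmersion (φ : M → N) : Prop where
  smooth : ContMDiff I J ∞ φ
  inner_eq : ∀ (x : M) (u v : TangentSpace I x),
    inner ℝ (mfderiv I J φ x u) (mfderiv I J φ x v) = inner ℝ u v

/-- The connection on `φ⁻¹TN` induced by the Levi-Civita connection of `N`:
`covAlong I J φ V x v` is `(∇̄_v V)(x)` for a section `V` of `φ⁻¹TN`. In the trivialization `t` of
`TN` given by the chart at `φ x`, with coordinate fields `∂_a` and `V = ∑ V^a (∂_a ∘ φ)`, it is
`∑ dV^a(v) ∂_a + ∑ V^a(x) ∇^N_{dφ(v)} ∂_a`; the second sum is `∇^N_{dφ(v)}` of the field with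
constant components that extends `V x`. -/
def covAlong (φ : M → N) (V : Π x : M, TangentSpace J (φ x)) (x : M) :
    TangentSpace I x →L[ℝ] TangentSpace J (φ x) :=
  let t := trivializationAt F (fun y : N ↦ TangentSpace J y) (φ x)
  t.symmL ℝ (φ x) ∘L mvfderiv I (fun z ↦ (t ⟨φ z, V z⟩).2) x
    + leviCivita J N (FiberBundle.extend F (V x)) (φ x) ∘L mfderiv I J φ x

/-- The second fundamental form `B(φ)(u, v) = ∇̄_u (dφ(Y)) - dφ(∇_u Y)`, where `Y` is the extension of
`v` with constant components in the chart at `x`. -/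
def secondFundamentalForm (φ : M → N) (x : M) (u v : TangentSpace I x) : TangentSpace J (φ x) :=
  let Y : Π z : M, TangentSpace I z := FiberBundle.extend E v
  covAlong I J φ (fun z ↦ mfderiv I J φ z (Y z)) x u - mfderiv I J φ x (leviCivita I M Y x u)

/-- The tension field `τ(φ) = ∑ B(φ)(e_i, e_i)`. -/
def tension (φ : M → N) (x : M) : TangentSpace J (φ x) :=
  let e := stdOrthonormalBasis ℝ (TangentSpace I x)
  ∑ i, secondFundamentalForm I J φ x (e i) (e i)

/-- The second covariant derivative `∇̄_u ∇̄_Y V - ∇̄_{∇_u Y} V` of a section `V` of `φ⁻¹TN`, where `Y`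
is the extension of `v` with constant components in the chart at `x`. -/
def secondCovAlong (φ : M → N) (V : Π x : M, TangentSpace J (φ x)) (x : M)
    (u v : TangentSpace I x) : TangentSpace J (φ x) :=
  let Y : Π z : M, TangentSpace I z := FiberBundle.extend E v
  covAlong I J φ (fun z ↦ covAlong I J φ V z (Y z)) x u
    - covAlong I J φ V x (leviCivita I M Y x u)

/-- The rough Laplacian `Δ̄V = -∑ (∇̄_{e_i} ∇̄_{e_i} V - ∇̄_{∇_{e_i} e_i} V)` on sections of `φ⁻¹TN`. -/
def roughLaplacian (φ : M → N) (V : Π x : M, TangentSpace J (φ x)) (x : M) :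
    TangentSpace J (φ x) :=
  let e := stdOrthonormalBasis ℝ (TangentSpace I x);
  -∑ i, secondCovAlong I J φ V x (e i) (e i)

/-- The Jacobi operator `J(V) = Δ̄V - ∑ R^N(V, dφ(e_i)) dφ(e_i)`. -/
def jacobiOperator (φ : M → N) (V : Π x : M, TangentSpace J (φ x)) (x : M) :
    TangentSpace J (φ x) :=
  let e := stdOrthonormalBasis ℝ (TangentSpace I x)
  roughLaplacian I J φ V x
    - ∑ i, curvature J (V x) (mfderiv I J φ x (e i)) (mfderiv I J φ x (e i))

/-- The tritension field `τ₃(φ) = J(Δ̄τ(φ)) - ∑ R^N(∇̄_{e_i} τ(φ), τ(φ)) dφ(e_i)`. -/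
def tritension (φ : M → N) (x : M) : TangentSpace J (φ x) :=
  let e := stdOrthonormalBasis ℝ (TangentSpace I x)
  jacobiOperator I J φ (roughLaplacian I J φ (tension I J φ)) x
    - ∑ i, curvature J (covAlong I J φ (tension I J φ) x (e i)) (tension I J φ x)
        (mfderiv I J φ x (e i))

end Maps

end

end RiemGeom

open RiemGeom

namespace RiemGeom

open Filter Topology

set_option linter.unusedSectionVars false

section Calculus

variable {E : Type*} [NormedAddCommGroup E] [NormedSpace ℝ E]
  {H : Type*} [TopologicalSpace H] {I : ModelWithCorners ℝ E H}
  {M : Type*} [TopologicalSpace M] [ChartedSpace H M] [IsManifold I ∞ M]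
  {F : Type*} [NormedAddCommGroup F] [NormedSpace ℝ F]
  {G : Type*} [TopologicalSpace G] {J : ModelWithCorners ℝ F G}
  {N : Type*} [TopologicalSpace N] [ChartedSpace G N] [IsManifold J ∞ N]

theorem contMDiffAt_mfderiv_apply {φ : M → N} {X : Π z : M, TangentSpace I z} {x : M}
    (hφ : CMDiffAt ∞ φ x) (hX : CMDiffAt ∞ (T% X) x) :
    CMDiffAt ∞ (fun z ↦ (⟨φ z, mfderiv I J φ z (X z)⟩ : TangentBundle J N)) x :=
  ContMDiffAt.clm_apply_of_inCoordinates (hφ.mfderiv_const (m := ∞) (by simp)) hX hφ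

theorem contMDiffAt_mvfderiv_apply {f : M → F} {X : Π z : M, TangentSpace I z} {x : M}
    (hf : CMDiffAt ∞ f x) (hX : CMDiffAt ∞ (T% X) x) :
    CMDiffAt ∞ (fun z ↦ mvfderiv I f z (X z)) x :=
  (contMDiff_snd_tangentBundle_modelSpace F 𝓘(ℝ, F)).contMDiffAt.comp x
    (contMDiffAt_mfderiv_apply hf hX)

theorem trivializationAt_snd_eq_mfderiv {x z : M} (hz : z ∈ (chartAt H x).source)
    (w : TangentSpace I z) :
    (trivializationAt E (TangentSpace I) x ⟨z, w⟩).2 = mvfderiv I (extChartAt I x) z w := by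
  have hz' : z ∈ (trivializationAt E (TangentSpace I) x).baseSet := by simpa using hz
  have h := congr($(TangentBundle.continuousLinearMapAt_trivializationAt (I := I) hz) w)
  rw [Trivialization.continuousLinearMapAt_apply, Trivialization.linearMapAt_apply,
    if_pos hz'] at h
  exact h

theorem trivializationAt_self_snd {x : M} (v : TangentSpace I x) :
    (trivializationAt E (TangentSpace I) x ⟨x, v⟩).2 = v := by
  rw [trivializationAt_snd_eq_mfderiv (mem_chart_source H x)]
  exact congr($(mfderiv_extChartAt_self (I := I) (x := x)) v)

theorem mvfderiv_extChartAt_extend {x z : M} (v : TangentSpace I x)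
    (hz : z ∈ (chartAt H x).source) :
    mvfderiv I (extChartAt I x) z ((FiberBundle.extend E v : Π z : M, TangentSpace I z) z) = v := by
  have hz' : z ∈ (trivializationAt E (TangentSpace I) x).baseSet := by simpa using hz
  rw [← trivializationAt_snd_eq_mfderiv hz, FiberBundle.extend,
    Trivialization.apply_mk_symm _ hz', trivializationAt_self_snd]

theorem extend_eq_mpullback {x z : M} (v : TangentSpace I x) (hz : z ∈ (chartAt H x).source) :
    (FiberBundle.extend E v : Π z : M, TangentSpace I z) z =
      mpullback I 𝓘(ℝ, E) (extChartAt I x) (fun _ ↦ (v : E)) z := by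
  have hinv : (mfderiv I 𝓘(ℝ, E) (extChartAt I x) z).IsInvertible :=
    isInvertible_mfderiv_extChartAt (by simpa using hz)
  have h : mfderiv I 𝓘(ℝ, E) (extChartAt I x) z
      ((FiberBundle.extend E v : Π z : M, TangentSpace I z) z) = v :=
    mvfderiv_extChartAt_extend v hz
  change _ = (mfderiv I 𝓘(ℝ, E) (extChartAt I x) z).inverse (v : E)
  conv_rhs => rw [← h]
  exact (hinv.inverse_apply_self _).symm

theorem mlieBracket_extend_eq_zero [CompleteSpace E] {x z : M} (v w : TangentSpace I x)
    (hz : z ∈ (chartAt H x).source) :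
    mlieBracket I (FiberBundle.extend E v) (FiberBundle.extend E w) z = 0 := by
  have hs : (chartAt H x).source ∈ 𝓝 z := (chartAt H x).open_source.mem_nhds hz
  have key (u : TangentSpace I x) : (FiberBundle.extend E u : Π z : M, TangentSpace I z) =ᶠ[𝓝 z]
      mpullback I 𝓘(ℝ, E) (extChartAt I x) (fun _ ↦ (u : E)) :=
    eventually_of_mem hs fun y hy ↦ extend_eq_mpullback u hy
  have hc (u : E) : MDifferentiableAt 𝓘(ℝ, E) 𝓘(ℝ, E).tangent
      (fun p : E ↦ (⟨p, u⟩ : TangentBundle 𝓘(ℝ, E) E)) (extChartAt I x z) :=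
    ((contMDiffAt_vectorSpace_iff_contDiffAt (n := 1)).2 contDiffAt_const).mdifferentiableAt
      one_ne_zero
  have hI : IsManifold I (minSmoothness ℝ 3) M := by simp; infer_instance
  rw [(key v).mlieBracket_vectorField_eq (key w),
    ← mpullback_mlieBracket (n := 2) (hc v) (hc w)
      (contMDiffAt_extChartAt' hz) (by simp)]
  have h0 (V W : Π p : E, TangentSpace 𝓘(ℝ, E) p) (hV : ∀ p, fderivWithin ℝ (V : E → E) Set.univ p = 0)
      (hW : ∀ p, fderivWithin ℝ (W : E → E) Set.univ p = 0) : mlieBracket 𝓘(ℝ, E) V W = 0 := by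
    rw [← mlieBracketWithin_univ, mlieBracketWithin_eq_lieBracketWithin]
    funext p
    change fderivWithin ℝ (W : E → E) Set.univ p (V p) -
      fderivWithin ℝ (V : E → E) Set.univ p (W p) = 0
    rw [hV, hW]
    exact sub_self (0 : E)
  change (mfderiv I 𝓘(ℝ, E) (extChartAt I x) z).inverse
    (mlieBracket 𝓘(ℝ, E) (fun _ : E ↦ (v : E)) (fun _ : E ↦ (w : E)) (extChartAt I x z)) = 0
  refine (congrArg _ (congrFun (h0 (fun _ ↦ v) (fun _ ↦ w) (fun p ↦ fderivWithin_const_apply (x := p) (v : E))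
    fun p ↦ fderivWithin_const_apply (x := p) (w : E)) _)).trans ?_
  exact map_zero _

theorem _root_.Filter.EventuallyEq.mvfderiv_eq {f g : M → F} {x : M} (h : f =ᶠ[𝓝 x] g) :
    mvfderiv I f x = mvfderiv I g x := by
  have := h.mfderiv_eq (I := I) (I' := 𝓘(ℝ, F))
  ext v
  exact congr($this v)

theorem mvfderiv_comp_extChartAt {g : E → F} {x z : M} (hz : z ∈ (chartAt H x).source)
    (hg : DifferentiableAt ℝ g (extChartAt I x z)) (w : TangentSpace I z) :
    mvfderiv I (g ∘ extChartAt I x) z w =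
      fderiv ℝ g (extChartAt I x z) (mvfderiv I (extChartAt I x) z w) := by
  have h := mfderiv_comp_apply z hg.mdifferentiableAt (mdifferentiableAt_extChartAt (I := I) hz) w
  rw [mfderiv_eq_fderiv] at h
  exact h

/-- Second derivatives in the directions of coordinate fields commute. -/
theorem mvfderiv_mvfderiv_extend_comm [I.Boundaryless] {f : M → F} {x : M} (hf : CMDiffAt ∞ f x)
    (u v : TangentSpace I x) :
    mvfderiv I (fun z ↦ mvfderiv I f z ((FiberBundle.extend E v : Π z : M, TangentSpace I z) z)) x u
      = mvfderiv I
        (fun z ↦ mvfderiv I f z ((FiberBundle.extend E u : Π z : M, TangentSpace I z) z)) x v := by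
  set g : E → F := f ∘ (extChartAt I x).symm with hg
  have hgs : ContDiffAt ℝ ∞ g (extChartAt I x x) := by
    have h := (contMDiffAt_iff.1 hf).2
    rwa [I.range_eq_univ, contDiffWithinAt_univ] at h
  have key (w u : TangentSpace I x) :
      mvfderiv I
        (fun z ↦ mvfderiv I f z ((FiberBundle.extend E w : Π z : M, TangentSpace I z) z)) x u =
      fderiv ℝ (fderiv ℝ g) (extChartAt I x x) u w := by
    have hev : (fun z ↦ mvfderiv I f z
          ((FiberBundle.extend E w : Π z : M, TangentSpace I z) z)) =ᶠ[𝓝 x]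
        (fun p ↦ fderiv ℝ g p w) ∘ extChartAt I x := by
      have h1 : ∀ᶠ z in 𝓝 x, DifferentiableAt ℝ g (extChartAt I x z) :=
        (continuousAt_extChartAt x).eventually
          (((hgs.of_le (m := 1) (by simp)).eventually (by simp)).mono
            fun p hp ↦ hp.differentiableAt one_ne_zero)
      filter_upwards [h1, (chartAt H x).open_source.mem_nhds (mem_chart_source H x)] with z hz hzs
      have h2 : f =ᶠ[𝓝 z] g ∘ extChartAt I x := by
        filter_upwards [(chartAt H x).open_source.mem_nhds hzs] with y hy
        simp only [hg, Function.comp_apply]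
        rw [(extChartAt I x).left_inv (by simpa using hy)]
      rw [h2.mvfderiv_eq, mvfderiv_comp_extChartAt hzs hz, mvfderiv_extChartAt_extend w hzs]
      rfl
    have h3 : DifferentiableAt ℝ (fderiv ℝ g) (extChartAt I x x) :=
      (hgs.fderiv_right (m := 1) (by norm_num; exact ENat.LEInfty.out)).differentiableAt one_ne_zero
    have h4 (w : E) : fderiv ℝ (fun p ↦ fderiv ℝ g p w) (extChartAt I x x) =
        (fderiv ℝ (fderiv ℝ g) (extChartAt I x x)).flip w := by
      rw [fderiv_clm_apply h3 (differentiableAt_const _)]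
      simp
    have h5 : mvfderiv I (extChartAt I x) x u = u := by
      rw [← trivializationAt_snd_eq_mfderiv (mem_chart_source H x), trivializationAt_self_snd]
    have h6 (w : E) : DifferentiableAt ℝ (fun p ↦ fderiv ℝ g p w) (extChartAt I x x) :=
      h3.clm_apply (differentiableAt_const _)
    rw [hev.mvfderiv_eq]
    refine (mvfderiv_comp_extChartAt (mem_chart_source H x) (h6 w) u).trans ?_
    rw [h5]
    exact congr($(h4 w) u)
  rw [key, key]
  exact hgs.isSymmSndFDerivAt (by simp; exact ENat.LEInfty.out) u v

end Calculus

section Frames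

variable {E : Type*} [NormedAddCommGroup E] [NormedSpace ℝ E] [FiniteDimensional ℝ E]
  {H : Type*} [TopologicalSpace H] {I : ModelWithCorners ℝ E H}
  {M : Type*} [TopologicalSpace M] [ChartedSpace H M] [IsManifold I ∞ M]
  [RiemannianBundle (fun x : M ↦ TangentSpace I x)]
  [IsContMDiffRiemannianBundle I ∞ E (fun x : M ↦ TangentSpace I x)]

theorem contMDiffAt_inner {X Y : Π x : M, TangentSpace I x} {x : M}
    (hX : CMDiffAt ∞ (T% X) x) (hY : CMDiffAt ∞ (T% Y) x) :
    CMDiffAt ∞ (fun z ↦ inner ℝ (X z) (Y z)) x :=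
  ContMDiffAt.inner_bundle (F := E) (E := fun x : M ↦ TangentSpace I x) hX hY

theorem contMDiffAt_gramSchmidt {n : ℕ} {X : Fin n → Π x : M, TangentSpace I x} {x : M}
    (hX : ∀ i, CMDiffAt ∞ (T% (X i)) x) (hli : LinearIndependent ℝ (X · x)) (i : Fin n) :
    CMDiffAt ∞ (T% (fun z ↦ InnerProductSpace.gramSchmidt ℝ (X · z) i)) x := by
  induction i using WellFoundedLT.induction with
  | ind i ih =>
    have hsum : CMDiffAt ∞ (T% (fun z ↦ ∑ j ∈ Finset.Iio i,
        (inner ℝ (InnerProductSpace.gramSchmidt ℝ (X · z) j) (X i z) /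
          inner ℝ (InnerProductSpace.gramSchmidt ℝ (X · z) j)
            (InnerProductSpace.gramSchmidt ℝ (X · z) j)) •
          InnerProductSpace.gramSchmidt ℝ (X · z) j)) x := by
      refine .sum_section fun j hj ↦ ?_
      have hj' := ih j (Finset.mem_Iio.1 hj)
      refine ContMDiffAt.smul_section ?_ hj'
      refine (contMDiffAt_inner hj' (hX i)).div₀ (contMDiffAt_inner hj' hj') ?_
      exact inner_self_ne_zero.2 (InnerProductSpace.gramSchmidt_ne_zero j hli)
    refine ((hX i).sub_section hsum).congr_of_eventuallyEq (.of_forall fun z ↦ ?_)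
    have h := InnerProductSpace.gramSchmidt_def'' ℝ (X · z) i
    simp only [RCLike.ofReal_real_eq_id, id, ← real_inner_self_eq_norm_sq] at h
    exact congrArg (TotalSpace.mk' E z) (eq_sub_of_add_eq h.symm)

/-- Near every point there is a smooth local orthonormal frame of the tangent bundle. -/
theorem exists_contMDiffAt_orthonormalBasis (x : M) :
    ∃ e : Fin (Module.finrank ℝ E) → Π z : M, TangentSpace I z, (∀ i, CMDiffAt ∞ (T% (e i)) x) ∧
      ∀ᶠ z in 𝓝 x, ∃ b : OrthonormalBasis (Fin (Module.finrank ℝ E)) ℝ (TangentSpace I z),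
        ∀ i, b i = e i z := by
  let t := trivializationAt E (fun z : M ↦ TangentSpace I z) x
  let X := t.localFrame (Module.finBasis ℝ E)
  have hfr := t.isLocalFrameOn_localFrame_baseSet I ∞ (Module.finBasis ℝ E)
  have hx : x ∈ t.baseSet := FiberBundle.mem_baseSet_trivializationAt' x
  have hX (i) : CMDiffAt ∞ (T% (X i)) x := hfr.contMDiffAt t.open_baseSet hx i
  have hG := contMDiffAt_gramSchmidt hX (hfr.linearIndependent hx)
  refine ⟨fun i z ↦ InnerProductSpace.gramSchmidtNormed ℝ (X · z) i, fun i ↦ ?_, ?_⟩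
  · have hne := inner_self_ne_zero (𝕜 := ℝ).2
      (InnerProductSpace.gramSchmidt_ne_zero i (hfr.linearIndependent hx))
    have hn : CMDiffAt ∞ (fun z ↦ (√(inner ℝ (InnerProductSpace.gramSchmidt ℝ (X · z) i)
        (InnerProductSpace.gramSchmidt ℝ (X · z) i)))⁻¹) x := by
      refine ContMDiffAt.inv₀ ?_ ?_
      · exact (Real.contDiffAt_sqrt hne).contMDiffAt.comp x (contMDiffAt_inner (hG i) (hG i))
      · rw [← norm_eq_sqrt_real_inner]
        simpa using hne
    refine (hn.smul_section (hG i)).congr_of_eventuallyEq (.of_forall fun z ↦ ?_)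
    refine congrArg (TotalSpace.mk' E z) ?_
    change (‖InnerProductSpace.gramSchmidt ℝ (X · z) i‖ : ℝ)⁻¹ • _ = _
    rw [norm_eq_sqrt_real_inner]
    rfl
  · filter_upwards [t.open_baseSet.mem_nhds hx] with z hz
    have ho := InnerProductSpace.gramSchmidtNormed_orthonormal (𝕜 := ℝ) (hfr.linearIndependent hz)
    have hsp : ⊤ ≤ Submodule.span ℝ (Set.range
        (InnerProductSpace.gramSchmidtNormed ℝ (X · z))) := by
      rw [InnerProductSpace.span_gramSchmidtNormed_range, InnerProductSpace.span_gramSchmidt]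
      exact hfr.generating hz
    exact ⟨OrthonormalBasis.mk ho hsp, fun i ↦ congrFun (OrthonormalBasis.coe_mk ho hsp) i⟩

theorem contMDiffAt_koszul {X Y Z : Π x : M, TangentSpace I x} {x : M}
    (hX : CMDiffAt ∞ (T% X) x) (hY : CMDiffAt ∞ (T% Y) x) (hZ : CMDiffAt ∞ (T% Z) x) :
    CMDiffAt ∞ (koszul I X Y Z) x := by
  have hb {X Y : Π x : M, TangentSpace I x}
      (hX : CMDiffAt ∞ (T% X) x) (hY : CMDiffAt ∞ (T% Y) x) :
      CMDiffAt ∞ (T% (mlieBracket I X Y)) x := by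
    have : IsManifold I (∞ + 1) M := by simpa using ‹IsManifold I ∞ M›
    have : IsManifold I (minSmoothness ℝ 2) M := by simp; infer_instance
    exact ContMDiffAt.mlieBracket_vectorField (m := ⊤) (n := ⊤) hX hY (by simp)
  unfold koszul
  have h1 := contMDiffAt_mvfderiv_apply (contMDiffAt_inner hY hZ) hX
  have h2 := contMDiffAt_mvfderiv_apply (contMDiffAt_inner hZ hX) hY
  have h3 := contMDiffAt_mvfderiv_apply (contMDiffAt_inner hX hY) hZ
  have h4 := contMDiffAt_inner (hb hX hY) hZ
  have h5 := contMDiffAt_inner (hb hX hZ) hY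
  have h6 := contMDiffAt_inner (hb hY hZ) hX
  simp only [div_eq_mul_inv]
  exact (((((h1.add h2).sub h3).add h4).sub h5).sub h6).mul contMDiffAt_const

theorem eventually_mdifferentiableAt {X : Π x : M, TangentSpace I x} {x : M}
    (hX : CMDiffAt ∞ (T% X) x) : ∀ᶠ z in 𝓝 x, MDiffAt (T% X) z :=
  ((contMDiffAt_iff_contMDiffAt_nhds (by simp)).1 (hX.of_le (m := 1) (by simp))).mono
    fun _ h ↦ h.mdifferentiableAt one_ne_zero

/-- The Levi-Civita derivative of a smooth field along a smooth field is smooth. -/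
theorem contMDiffAt_leviCivita {X Y : Π x : M, TangentSpace I x} {x : M}
    (hX : CMDiffAt ∞ (T% X) x) (hY : CMDiffAt ∞ (T% Y) x) :
    CMDiffAt ∞ (T% (fun z ↦ leviCivita I M Y z (X z))) x := by
  obtain ⟨e, he, hb⟩ := exists_contMDiffAt_orthonormalBasis (I := I) x
  have h : CMDiffAt ∞ (T% (fun z ↦ ∑ i, koszul I X Y (e i) z • e i z)) x :=
    .sum_section fun i _ ↦ (contMDiffAt_koszul hX hY (he i)).smul_section (he i)
  refine h.congr_of_eventuallyEq ?_
  filter_upwards [hb, eventually_mdifferentiableAt hX, eventually_mdifferentiableAt hY,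
    eventually_all.2 fun i ↦ eventually_mdifferentiableAt (he i)] with z ⟨b, hbz⟩ hXz hYz hez
  congr 1
  rw [← b.sum_repr' (leviCivita I M Y z (X z))]
  refine Finset.sum_congr rfl fun i _ ↦ ?_
  rw [hbz i, ← inner_leviCivitaFun I hXz hYz (hez i), real_inner_comm]
  rfl

end Frames

/-- A form, additive in each slot, with the symmetries of a curvature tensor vanishes if its
sectional values do. -/
theorem curvatureLike_eq_zero {V : Type*} [AddCommGroup V] (T : V → V → V → V → ℝ)
    (add₁ : ∀ u u' v w z, T (u + u') v w z = T u v w z + T u' v w z)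
    (add₃ : ∀ u v w w' z, T u v (w + w') z = T u v w z + T u v w' z)
    (add₄ : ∀ u v w z z', T u v w (z + z') = T u v w z + T u v w z')
    (skew₁₂ : ∀ u v w z, T u v w z = -T v u w z) (skew₃₄ : ∀ u v w z, T u v w z = -T u v z w)
    (bianchi : ∀ u v w z, T u v w z + T v w u z + T w u v z = 0)
    (sect : ∀ u v, T u v v u = 0) (u v w z : V) : T u v w z = 0 := by
  have add₂ (u v v' w z : V) : T u (v + v') w z = T u v w z + T u v' w z := by
    rw [skew₁₂, add₁, skew₁₂ v u, skew₁₂ v' u]; ring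
  have pair (u v w z : V) : T u v w z = T w z u v := by
    linarith [bianchi u v w z, bianchi v w z u, bianchi w z u v, bianchi z u v w,
      skew₁₂ u v w z, skew₁₂ v w u z, skew₁₂ w u v z, skew₁₂ v w z u, skew₁₂ w z v u,
      skew₁₂ z v w u, skew₁₂ w z u v, skew₁₂ z u w v, skew₁₂ u w z v, skew₁₂ z u v w,
      skew₁₂ u v z w, skew₁₂ v z u w, skew₃₄ u v w z, skew₃₄ v w u z, skew₃₄ w u v z,
      skew₃₄ w z v u, skew₃₄ z v w u, skew₃₄ z u w v, skew₃₄ u w z v, skew₃₄ v z u w,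
      skew₃₄ z u v w, skew₃₄ v w z u, skew₃₄ w z u v]
  have polar₁ (u v u' : V) : T u v v u' = 0 := by
    have h := sect (u + u') v
    rw [add₁, add₄, add₄, sect, sect, pair u' v v u, skew₁₂ v u, skew₃₄ u v u' v] at h
    linarith
  have polar₂ (u v w z : V) : T u v w z = -T u w v z := by
    have h := polar₁ u (v + w) z
    rw [add₂, add₃, add₃, polar₁, polar₁] at h
    linarith
  linarith [bianchi u v w z, polar₂ v w u z, skew₁₂ v u w z, skew₁₂ w u v z, polar₂ u w v z]

section Curvature

variable {F : Type*} [NormedAddCommGroup F] [NormedSpace ℝ F] [FiniteDimensional ℝ F]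
  {G : Type*} [TopologicalSpace G] {J : ModelWithCorners ℝ F G}
  {N : Type*} [TopologicalSpace N] [ChartedSpace G N] [IsManifold J ∞ N]

/-- The extension of a tangent vector with constant components in the chart. -/
noncomputable abbrev extendField {y : N} (u : TangentSpace J y) : Π z : N, TangentSpace J z :=
  FiberBundle.extend F u

theorem extendField_apply {y z : N} (u : TangentSpace J y) (hz : z ∈ (chartAt G y).source) :
    extendField u z =
      (trivializationAt F (TangentSpace J) y).symmL ℝ z (u : F) := by
  have hz' : z ∈ (trivializationAt F (TangentSpace J) y).baseSet := by simpa using hz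
  change (trivializationAt F (TangentSpace J) y).symm z _ = _
  rw [trivializationAt_self_snd]
  exact (Trivialization.symmL_apply (R := ℝ) _ hz' (u : F)).symm

theorem extendField_add {y : N} (u v : TangentSpace J y) :
    extendField (u + v) =ᶠ[𝓝 y] extendField u + extendField v := by
  filter_upwards [(chartAt G y).open_source.mem_nhds (mem_chart_source G y)] with z hz
  rw [Pi.add_apply, extendField_apply _ hz, extendField_apply _ hz, extendField_apply _ hz]
  exact map_add _ (u : F) (v : F)

theorem extendField_smul {y : N} (a : ℝ) (u : TangentSpace J y) :
    extendField (a • u) =ᶠ[𝓝 y] a • extendField u := by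
  filter_upwards [(chartAt G y).open_source.mem_nhds (mem_chart_source G y)] with z hz
  rw [Pi.smul_apply, extendField_apply _ hz, extendField_apply _ hz]
  exact map_smul _ a (u : F)

theorem contMDiffAt_extendField {y : N} (u : TangentSpace J y) :
    CMDiffAt ∞ (T% (extendField u)) y :=
  FiberBundle.contMDiffAt_extend J F u

variable [RiemannianBundle (fun y : N ↦ TangentSpace J y)]
  [IsContMDiffRiemannianBundle J ∞ F (fun y : N ↦ TangentSpace J y)]

theorem leviCivita_congr {X Y : Π z : N, TangentSpace J z} {y : N} (hX : MDiffAt (T% X) y)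
    (h : X =ᶠ[𝓝 y] Y) : leviCivita J N X y = leviCivita J N Y y :=
  (leviCivita J N).isCovariantDerivativeOnUniv.congr_of_eventuallyEq hX
    (hX.congr_of_eventuallyEq (h.symm.mono fun z hz ↦ congrArg (TotalSpace.mk' F z) hz)) univ_mem h

theorem leviCivita_add {X Y : Π z : N, TangentSpace J z} {y : N} (hX : MDiffAt (T% X) y)
    (hY : MDiffAt (T% Y) y) :
    leviCivita J N (X + Y) y = leviCivita J N X y + leviCivita J N Y y :=
  (leviCivita J N).isCovariantDerivativeOnUniv.add hX hY

theorem leviCivita_smul {X : Π z : N, TangentSpace J z} {f : N → ℝ} {y : N}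
    (hf : MDiffAt f y) (hX : MDiffAt (T% X) y) (v : TangentSpace J y) :
    leviCivita J N (f • X) y v = f y • leviCivita J N X y v + mvfderiv J f y v • X y := by
  rw [(leviCivita J N).isCovariantDerivativeOnUniv.leibniz hX hf]
  rfl

theorem leviCivita_const_smul {X : Π z : N, TangentSpace J z} {y : N} (a : ℝ)
    (hX : MDiffAt (T% X) y) : leviCivita J N (a • X) y = a • leviCivita J N X y :=
  (leviCivita J N).isCovariantDerivativeOnUniv.smul_const a hX

theorem mvfderiv_inner {X Y : Π z : N, TangentSpace J z} {y : N}
    (hX : MDiffAt (T% X) y) (hY : MDiffAt (T% Y) y) (v : TangentSpace J y) :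
    mvfderiv J (fun z ↦ inner ℝ (X z) (Y z)) y v =
      inner ℝ (leviCivita J N X y v) (Y y) + inner ℝ (X y) (leviCivita J N Y y v) := by
  have h := (isMetricCompatible_leviCivita J (M := N)).mvfderiv_inner_eq (extendField v) hX hY
  simpa using h

/-- `covExtend v w` is the field `∇_V W`, where `V` and `W` extend `v` and `w` with constant
components. -/
noncomputable def covExtend {y : N} (v w : TangentSpace J y) : Π z : N, TangentSpace J z :=
  fun z ↦ leviCivita J N (extendField w) z (extendField v z)

theorem mdifferentiableAt_covExtend {y : N} (v w : TangentSpace J y) :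
    MDiffAt (T% (covExtend v w)) y :=
  (contMDiffAt_leviCivita (contMDiffAt_extendField v)
    (contMDiffAt_extendField w)).mdifferentiableAt (by simp)

theorem eventually_mdifferentiableAt_extendField {y : N} (u : TangentSpace J y) :
    ∀ᶠ z in 𝓝 y, MDiffAt (T% (extendField u)) z :=
  eventually_mdifferentiableAt (contMDiffAt_extendField u)

theorem mdifferentiableAt_extendField {y : N} (u : TangentSpace J y) :
    MDiffAt (T% (extendField u)) y :=
  (eventually_mdifferentiableAt_extendField u).self_of_nhds

theorem covExtend_add_left {y : N} (v v' w : TangentSpace J y) :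
    covExtend (v + v') w =ᶠ[𝓝 y] covExtend v w + covExtend v' w := by
  filter_upwards [extendField_add v v'] with z hz
  rw [covExtend, hz]
  exact map_add _ _ _

theorem covExtend_smul_left {y : N} (a : ℝ) (v w : TangentSpace J y) :
    covExtend (a • v) w =ᶠ[𝓝 y] a • covExtend v w := by
  filter_upwards [extendField_smul a v] with z hz
  rw [covExtend, hz]
  exact map_smul _ _ _

theorem covExtend_add_right {y : N} (v w w' : TangentSpace J y) :
    covExtend v (w + w') =ᶠ[𝓝 y] covExtend v w + covExtend v w' := by
  filter_upwards [eventually_mdifferentiableAt_extendField w,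
    eventually_mdifferentiableAt_extendField w',
    eventually_mdifferentiableAt_extendField (w + w'),
    (extendField_add w w').eventuallyEq_nhds] with z hz hz' hz'' h
  rw [covExtend, leviCivita_congr hz'' h, leviCivita_add hz hz']
  rfl

theorem covExtend_comm {y : N} (v w : TangentSpace J y) :
    covExtend v w =ᶠ[𝓝 y] covExtend w v := by
  filter_upwards [eventually_mdifferentiableAt_extendField v,
    eventually_mdifferentiableAt_extendField w,
    (chartAt G y).open_source.mem_nhds (mem_chart_source G y)] with z hv hw hz
  have h := (CovariantDerivative.torsion_eq_zero_iff _).1 (torsion_leviCivita J (M := N)) hv hw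
  rw [mlieBracket_extend_eq_zero v w hz] at h
  exact sub_eq_zero.1 h

theorem curvature_eq {y : N} (u v w : TangentSpace J y) :
    curvature J u v w =
      leviCivita J N (covExtend v w) y u - leviCivita J N (covExtend u w) y v := by
  have h := mlieBracket_extend_eq_zero u v (mem_chart_source G y)
  simp only [curvature, h, map_zero, sub_zero]
  rfl

theorem curvature_swap {y : N} (u v w : TangentSpace J y) :
    curvature J u v w = -curvature J v u w := by
  rw [curvature_eq, curvature_eq, neg_sub]

theorem curvature_add_left {y : N} (u u' v w : TangentSpace J y) :
    curvature J (u + u') v w = curvature J u v w + curvature J u' v w := by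
  have h := leviCivita_congr (mdifferentiableAt_covExtend _ _) (covExtend_add_left u u' w)
  simp only [curvature_eq, h, map_add, leviCivita_add
    (mdifferentiableAt_covExtend u w) (mdifferentiableAt_covExtend u' w), add_apply]
  abel

theorem curvature_smul_left {y : N} (a : ℝ) (u v w : TangentSpace J y) :
    curvature J (a • u) v w = a • curvature J u v w := by
  have h := leviCivita_congr (mdifferentiableAt_covExtend _ _) (covExtend_smul_left a u w)
  simp only [curvature_eq, h, map_smul, leviCivita_const_smul a
    (mdifferentiableAt_covExtend u w), smul_apply, smul_sub]

theorem curvature_add_right {y : N} (u v w w' : TangentSpace J y) :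
    curvature J u v (w + w') = curvature J u v w + curvature J u v w' := by
  have h (v : TangentSpace J y) : leviCivita J N (covExtend v (w + w')) y =
      leviCivita J N (covExtend v w) y + leviCivita J N (covExtend v w') y := by
    rw [leviCivita_congr (mdifferentiableAt_covExtend _ _) (covExtend_add_right v w w'),
      leviCivita_add (mdifferentiableAt_covExtend v w) (mdifferentiableAt_covExtend v w')]
  simp only [curvature_eq, h, add_apply]
  abel

theorem curvature_bianchi {y : N} (u v w : TangentSpace J y) :
    curvature J u v w + curvature J v w u + curvature J w u v = 0 := by
  have h (v w : TangentSpace J y) :=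
    leviCivita_congr (mdifferentiableAt_covExtend v w) (covExtend_comm v w)
  rw [curvature_eq, curvature_eq, curvature_eq, h v w, h w u, h u v]
  abel

theorem inner_curvature_self [J.Boundaryless] {y : N} (u v w : TangentSpace J y) :
    inner ℝ (curvature J u v w) w = 0 := by
  have hW := contMDiffAt_extendField w
  have hf : CMDiffAt ∞ (fun z ↦ inner ℝ (extendField w z) (extendField w z)) y :=
    contMDiffAt_inner hW hW
  have key (u v : TangentSpace J y) :
      mvfderiv J (fun z ↦ mvfderiv J (fun z ↦ inner ℝ (extendField w z) (extendField w z)) z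
        (extendField v z)) y u = 2 * (inner ℝ (leviCivita J N (covExtend v w) y u) w +
          inner ℝ (covExtend v w y) (covExtend u w y)) := by
    have hev : (fun z ↦ mvfderiv J (fun z ↦ inner ℝ (extendField w z) (extendField w z)) z
        (extendField v z)) =ᶠ[𝓝 y]
        fun z ↦ 2 * inner ℝ (covExtend v w z) (extendField w z) := by
      filter_upwards [eventually_mdifferentiableAt_extendField w] with z hz
      rw [mvfderiv_inner hz hz, real_inner_comm _ (extendField w z), covExtend]
      ring
    rw [hev.mvfderiv_eq, mvfderiv_fun_mul mdifferentiableAt_const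
      (mdiffAt_inner (mdifferentiableAt_covExtend v w) (mdifferentiableAt_extendField w))]
    have h := mvfderiv_inner (mdifferentiableAt_covExtend v w) (mdifferentiableAt_extendField w) u
    simp only [extendField, FiberBundle.extend_apply_self] at h
    simp only [mvfderiv_const, smul_zero, add_zero, smul_apply, smul_eq_mul, extendField, h]
    simp [covExtend]
  have h := mvfderiv_mvfderiv_extend_comm hf u v
  rw [key, key, real_inner_comm (covExtend u w y)] at h
  rw [curvature_eq, inner_sub_left]
  linarith

theorem inner_curvature_swap [J.Boundaryless] {y : N} (u v w z : TangentSpace J y) :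
    inner ℝ (curvature J u v w) z = -inner ℝ (curvature J u v z) w := by
  have h := inner_curvature_self u v (w + z)
  rw [curvature_add_right, inner_add_left, inner_add_right, inner_add_right,
    inner_curvature_self, inner_curvature_self] at h
  linarith

theorem HasConstantCurvature.inner_curvature [J.Boundaryless] {c : ℝ}
    (hN : HasConstantCurvature J N c) {y : N} (u v : TangentSpace J y) :
    inner ℝ (curvature J u v v) u = c * (inner ℝ u u * inner ℝ v v - inner ℝ u v ^ 2) := by
  by_cases hli : LinearIndependent ℝ ![u, v]
  · have h := hN y u v hli
    rw [sectionalCurvature, div_eq_iff] at h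
    · exact h
    · intro h0
      have h1 : inner ℝ (inner ℝ v v • u - inner ℝ u v • v)
          (inner ℝ v v • u - inner ℝ u v • v) = 0 := by
        simp only [inner_sub_left, inner_sub_right, real_inner_smul_left, real_inner_smul_right]
        rw [real_inner_comm u v]
        linear_combination inner ℝ v v * h0
      have h2 := LinearIndependent.pair_iff.1 hli (inner ℝ v v) (-inner ℝ u v)
        (by rw [neg_smul, ← sub_eq_add_neg]; exact inner_self_eq_zero.1 h1)
      exact hli.ne_zero 1 (inner_self_eq_zero.1 h2.1)
  · have hself (u w : TangentSpace J y) : curvature J u u w = 0 := by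
      rw [RiemGeom.curvature_eq, sub_self]
    rw [LinearIndependent.pair_iff] at hli
    push Not at hli
    obtain ⟨a, b, hab, hne⟩ := hli
    by_cases ha : a = 0
    · subst ha
      have hv : v = 0 := by simpa [hne rfl] using hab
      subst hv
      have h0 : curvature J u 0 (0 : TangentSpace J y) = 0 := by
        rw [curvature_swap]
        simpa using curvature_smul_left 0 (0 : TangentSpace J y) u 0
      simp [h0]
    · have hu : u = (-(b / a)) • v := by
        have : a • u = (-b) • v := by rw [neg_smul]; exact eq_neg_of_add_eq_zero_left hab
        rw [← inv_smul_smul₀ ha u, this, smul_smul]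
        congr 1
        field_simp
      rw [hu, curvature_smul_left, hself]
      simp only [smul_zero, inner_zero_left, real_inner_smul_left, real_inner_smul_right]
      ring

/-- The curvature tensor of a space of constant curvature. -/
theorem HasConstantCurvature.curvature_eq [J.Boundaryless] {c : ℝ}
    (hN : HasConstantCurvature J N c) {y : N} (u v w : TangentSpace J y) :
    curvature J u v w = c • (inner ℝ v w • u - inner ℝ u w • v) := by
  refine ext_inner_right ℝ fun z ↦ sub_eq_zero.1 ?_
  refine curvatureLike_eq_zero (fun u v w z ↦ inner ℝ (curvature J u v w) z -
    inner ℝ (c • (inner ℝ v w • u - inner ℝ u w • v)) z) ?_ ?_ ?_ ?_ ?_ ?_ ?_ u v w z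
  · intro u u' v w z
    simp only [curvature_add_left, inner_add_left, inner_smul_left, inner_sub_left, smul_add]
    simp
    ring
  · intro u v w w' z
    simp only [curvature_add_right, inner_add_left, inner_add_right, inner_smul_left,
      inner_sub_left]
    simp
    ring
  · intro u v w z z'
    simp only [inner_add_right]
    ring
  · intro u v w z
    rw [curvature_swap]
    simp only [inner_neg_left, inner_smul_left, inner_sub_left]
    ring
  · intro u v w z
    rw [inner_curvature_swap]
    simp only [inner_smul_left, inner_sub_left]
    simp
    ring
  · intro u v w z
    have h := congr(inner ℝ $(curvature_bianchi u v w) z)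
    simp only [inner_add_left, inner_zero_left] at h
    simp only [inner_smul_left, inner_sub_left]
    rw [real_inner_comm u w, real_inner_comm v w, real_inner_comm u v]
    linear_combination h
  · intro u v
    rw [hN.inner_curvature]
    simp only [inner_smul_left, inner_sub_left]
    rw [real_inner_comm u v]
    simp
    ring

end Curvature

section Along

variable {E : Type*} [NormedAddCommGroup E] [NormedSpace ℝ E] [FiniteDimensional ℝ E]
  {H : Type*} [TopologicalSpace H] {I : ModelWithCorners ℝ E H}
  {M : Type*} [TopologicalSpace M] [ChartedSpace H M] [IsManifold I ∞ M]
  {F : Type*} [NormedAddCommGroup F] [NormedSpace ℝ F] [FiniteDimensional ℝ F]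
  {G : Type*} [TopologicalSpace G] {J : ModelWithCorners ℝ F G}
  {N : Type*} [TopologicalSpace N] [ChartedSpace G N] [IsManifold J ∞ N]

/-- A section of `φ⁻¹TN`, as a map into the total space of `TN`. -/
abbrev sectionAlong (φ : M → N) (V : Π z : M, TangentSpace J (φ z)) : M → TangentBundle J N :=
  fun z ↦ ⟨φ z, V z⟩

/-- The components of a section of `φ⁻¹TN` in the chart at `φ x`. -/
noncomputable def coordAlong (φ : M → N) (V : Π z : M, TangentSpace J (φ z)) (x : M) : M → F :=
  fun z ↦ (trivializationAt F (fun y : N ↦ TangentSpace J y) (φ x) ⟨φ z, V z⟩).2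

variable {φ : M → N} {V V' : Π z : M, TangentSpace J (φ z)} {x : M}

theorem coordAlong_apply {z : M} (hz : φ z ∈ (chartAt G (φ x)).source) :
    coordAlong φ V x z = mvfderiv J (extChartAt J (φ x)) (φ z) (V z) :=
  trivializationAt_snd_eq_mfderiv hz (V z)

theorem eventually_mem_chart_source (hφ : ContinuousAt φ x) :
    ∀ᶠ z in 𝓝 x, φ z ∈ (chartAt G (φ x)).source :=
  hφ.eventually ((chartAt G (φ x)).open_source.mem_nhds (mem_chart_source G (φ x)))

theorem coordAlong_add (hφ : ContinuousAt φ x) :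
    coordAlong φ (V + V') x =ᶠ[𝓝 x] coordAlong φ V x + coordAlong φ V' x := by
  filter_upwards [eventually_mem_chart_source (G := G) hφ] with z hz
  rw [Pi.add_apply, coordAlong_apply hz, coordAlong_apply hz, coordAlong_apply hz]
  exact map_add _ _ _

theorem coordAlong_smul (hφ : ContinuousAt φ x) (f : M → ℝ) :
    coordAlong φ (fun z ↦ f z • V z) x =ᶠ[𝓝 x] f • coordAlong φ V x := by
  filter_upwards [eventually_mem_chart_source (G := G) hφ] with z hz
  rw [Pi.smul_apply', coordAlong_apply hz, coordAlong_apply hz]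
  exact map_smul _ _ _

theorem coordAlong_extendField (hφ : ContinuousAt φ x) (w : TangentSpace J (φ x)) :
    coordAlong φ (fun z ↦ extendField w (φ z)) x =ᶠ[𝓝 x] fun _ ↦ w := by
  filter_upwards [eventually_mem_chart_source (G := G) hφ] with z hz
  rw [coordAlong_apply hz]
  exact mvfderiv_extChartAt_extend w hz

theorem symmL_coordAlong {z : M} (hz : φ z ∈ (chartAt G (φ x)).source) :
    (trivializationAt F (TangentSpace J) (φ x)).symmL ℝ (φ z) (coordAlong φ V x z) = V z := by
  have hz' : φ z ∈ (trivializationAt F (TangentSpace J) (φ x)).baseSet := by simpa using hz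
  rw [Trivialization.symmL_apply _ hz']
  exact Trivialization.symm_apply_apply_mk _ hz' (V z)

theorem mdifferentiableAt_sectionAlong_iff (hφ : MDiffAt φ x) :
    MDiffAt (sectionAlong φ V) x ↔ MDiffAt (coordAlong φ V x) x := by
  rw [mdifferentiableAt_totalSpace]
  exact and_iff_right hφ

theorem contMDiffAt_sectionAlong_iff {n : ℕ∞ω} (hφ : CMDiffAt n φ x) :
    CMDiffAt n (sectionAlong φ V) x ↔ CMDiffAt n (coordAlong φ V x) x := by
  rw [contMDiffAt_totalSpace]
  exact and_iff_right hφ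

theorem MDiffAlong.add (hφ : MDiffAt φ x) (hV : MDiffAt (sectionAlong φ V) x)
    (hV' : MDiffAt (sectionAlong φ V') x) : MDiffAt (sectionAlong φ (V + V')) x := by
  rw [mdifferentiableAt_sectionAlong_iff hφ] at *
  exact (MDifferentiableAt.add hV hV').congr_of_eventuallyEq (coordAlong_add hφ.continuousAt)

theorem MDiffAlong.smul (hφ : MDiffAt φ x) {f : M → ℝ} (hf : MDiffAt f x)
    (hV : MDiffAt (sectionAlong φ V) x) : MDiffAt (sectionAlong φ (fun z ↦ f z • V z)) x := by
  rw [mdifferentiableAt_sectionAlong_iff hφ] at *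
  exact (MDifferentiableAt.smul hf hV).congr_of_eventuallyEq (coordAlong_smul hφ.continuousAt f)

theorem CMDiffAlong.add (hφ : CMDiffAt ∞ φ x) (hV : CMDiffAt ∞ (sectionAlong φ V) x)
    (hV' : CMDiffAt ∞ (sectionAlong φ V') x) : CMDiffAt ∞ (sectionAlong φ (V + V')) x := by
  rw [contMDiffAt_sectionAlong_iff hφ] at *
  exact (hV.add hV').congr_of_eventuallyEq (coordAlong_add hφ.continuousAt)

theorem CMDiffAlong.smul (hφ : CMDiffAt ∞ φ x) {f : M → ℝ} (hf : CMDiffAt ∞ f x)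
    (hV : CMDiffAt ∞ (sectionAlong φ V) x) :
    CMDiffAt ∞ (sectionAlong φ (fun z ↦ f z • V z)) x := by
  rw [contMDiffAt_sectionAlong_iff hφ] at *
  exact (hf.smul hV).congr_of_eventuallyEq (coordAlong_smul hφ.continuousAt f)

theorem coordAlong_zero (hφ : ContinuousAt φ x) :
    coordAlong φ (fun z ↦ (0 : TangentSpace J (φ z))) x =ᶠ[𝓝 x] fun _ ↦ 0 := by
  filter_upwards [eventually_mem_chart_source (G := G) hφ] with z hz
  rw [coordAlong_apply hz]
  exact map_zero _

theorem MDiffAlong.sum (hφ : MDiffAt φ x) {ι : Type*} (s : Finset ι)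
    {V : ι → Π z : M, TangentSpace J (φ z)} (hV : ∀ i ∈ s, MDiffAt (sectionAlong φ (V i)) x) :
    MDiffAt (sectionAlong φ (fun z ↦ ∑ i ∈ s, V i z)) x := by
  classical
  induction s using Finset.induction_on with
  | empty =>
    simp only [Finset.sum_empty]
    rw [mdifferentiableAt_sectionAlong_iff hφ]
    exact mdifferentiableAt_const.congr_of_eventuallyEq (coordAlong_zero hφ.continuousAt)
  | insert a s ha ih =>
    simp only [Finset.sum_insert ha]
    exact MDiffAlong.add hφ (hV a (by simp)) (ih fun i hi ↦ hV i (by simp [hi]))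

theorem CMDiffAlong.sum (hφ : CMDiffAt ∞ φ x) {ι : Type*} (s : Finset ι)
    {V : ι → Π z : M, TangentSpace J (φ z)} (hV : ∀ i ∈ s, CMDiffAt ∞ (sectionAlong φ (V i)) x) :
    CMDiffAt ∞ (sectionAlong φ (fun z ↦ ∑ i ∈ s, V i z)) x := by
  classical
  induction s using Finset.induction_on with
  | empty =>
    simp only [Finset.sum_empty]
    rw [contMDiffAt_sectionAlong_iff hφ]
    exact contMDiffAt_const.congr_of_eventuallyEq (coordAlong_zero hφ.continuousAt)
  | insert a s ha ih =>
    simp only [Finset.sum_insert ha]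
    exact CMDiffAlong.add hφ (hV a (by simp)) (ih fun i hi ↦ hV i (by simp [hi]))

/-- The `a`-th component of a section of `φ⁻¹TN` in the chart at `φ x`. -/
noncomputable def coeffAlong (φ : M → N) (V : Π z : M, TangentSpace J (φ z)) (x : M)
    (a : Fin (Module.finrank ℝ F)) : M → ℝ :=
  fun z ↦ (Module.finBasis ℝ F).repr (coordAlong φ V x z) a

variable (J) in
/-- The `a`-th coordinate field of the chart at `y`. -/
noncomputable def coordField (y : N)
    (a : Fin (Module.finrank ℝ F)) : Π z : N, TangentSpace J z :=
  extendField (J := J) (y := y) (Module.finBasis ℝ F a : F)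

theorem contMDiffAt_coordField (y : N) (a : Fin (Module.finrank ℝ F)) :
    CMDiffAt ∞ (T% (coordField J y a)) y :=
  contMDiffAt_extendField _

theorem coordField_apply {y z : N} (hz : z ∈ (chartAt G y).source)
    (a : Fin (Module.finrank ℝ F)) : coordField J y a z =
      (trivializationAt F (TangentSpace J) y).symmL ℝ z (Module.finBasis ℝ F a) :=
  extendField_apply _ hz

theorem eq_sum_coordField {z : M} (hz : φ z ∈ (chartAt G (φ x)).source) :
    V z = ∑ a, coeffAlong φ V x a z • coordField J (φ x) a (φ z) := by
  rw [← symmL_coordAlong (V := V) hz]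
  simp only [coordField_apply hz, ← map_smul, ← map_sum]
  congr 1
  exact ((Module.finBasis ℝ F).sum_repr (coordAlong φ V x z)).symm

theorem mdifferentiableAt_coeffAlong (hφ : MDiffAt φ x) (hV : MDiffAt (sectionAlong φ V) x)
    (a : Fin (Module.finrank ℝ F)) : MDiffAt (coeffAlong φ V x a) x := by
  rw [mdifferentiableAt_sectionAlong_iff hφ] at hV
  have h : Differentiable ℝ (LinearMap.toContinuousLinearMap ((Module.finBasis ℝ F).coord a)) :=
    ContinuousLinearMap.differentiable _
  exact h.differentiableAt.mdifferentiableAt.comp x hV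

theorem contMDiffAt_coeffAlong (hφ : CMDiffAt ∞ φ x) (hV : CMDiffAt ∞ (sectionAlong φ V) x)
    (a : Fin (Module.finrank ℝ F)) : CMDiffAt ∞ (coeffAlong φ V x a) x := by
  rw [contMDiffAt_sectionAlong_iff hφ] at hV
  have h : ContDiff ℝ ∞ (LinearMap.toContinuousLinearMap ((Module.finBasis ℝ F).coord a)) :=
    ContinuousLinearMap.contDiff _
  exact h.contDiffAt.contMDiffAt.comp x hV

theorem mdifferentiableAt_sectionAlong_comp {W : Π y : N, TangentSpace J y} (hφ : MDiffAt φ x)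
    (hW : MDiffAt (T% W) (φ x)) : MDiffAt (sectionAlong φ (fun z ↦ W (φ z))) x :=
  hW.comp x hφ

theorem contMDiffAt_sectionAlong_comp {W : Π y : N, TangentSpace J y} (hφ : CMDiffAt ∞ φ x)
    (hW : CMDiffAt ∞ (T% W) (φ x)) : CMDiffAt ∞ (sectionAlong φ (fun z ↦ W (φ z))) x :=
  hW.comp x hφ

/-- An operation on sections of `φ⁻¹TN` that is linear over functions vanishes if it vanishes on
the sections with constant components. -/
theorem tensorialAlong_eq_zero {A : Type*} [AddCommGroup A] [Module ℝ A] (hφ : MDiffAt φ x)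
    (Φ : (Π z : M, TangentSpace J (φ z)) → A)
    (smul : ∀ (f : M → ℝ) (V), MDiffAt f x → MDiffAt (sectionAlong φ V) x →
      Φ (fun z ↦ f z • V z) = f x • Φ V)
    (add : ∀ V V', MDiffAt (sectionAlong φ V) x → MDiffAt (sectionAlong φ V') x →
      Φ (V + V') = Φ V + Φ V')
    (h0 : ∀ w : TangentSpace J (φ x), Φ (fun z ↦ extendField w (φ z)) = 0)
    (hV : MDiffAt (sectionAlong φ V) x) : Φ V = 0 := by
  classical
  set S : Π z : M, TangentSpace J (φ z) :=
    fun z ↦ ∑ a, coeffAlong φ V x a z • coordField J (φ x) a (φ z)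
  have hVS : ∀ᶠ z in 𝓝 x, V z = S z :=
    (eventually_mem_chart_source (G := G) hφ.continuousAt).mono fun z hz ↦ eq_sum_coordField hz
  have hterm (a) : MDiffAt (sectionAlong φ
      (fun z ↦ coeffAlong φ V x a z • coordField J (φ x) a (φ z))) x :=
    MDiffAlong.smul hφ (mdifferentiableAt_coeffAlong hφ hV a)
      (mdifferentiableAt_sectionAlong_comp hφ ((contMDiffAt_coordField _ a).mdifferentiableAt
        (by simp)))
  have hzero : Φ (fun z ↦ (0 : TangentSpace J (φ z))) = 0 := by
    have h := smul (fun _ ↦ 0) (fun z ↦ (0 : TangentSpace J (φ z))) mdifferentiableAt_const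
      (by simpa using MDiffAlong.sum hφ (∅ : Finset ℕ) (V := fun _ z ↦ 0) (by simp))
    simpa using h
  have hsum (s : Finset (Fin (Module.finrank ℝ F))) :
      Φ (fun z ↦ ∑ a ∈ s, coeffAlong φ V x a z • coordField J (φ x) a (φ z)) = 0 := by
    induction s using Finset.induction_on with
    | empty => simpa using hzero
    | insert a s ha ih =>
      simp only [Finset.sum_insert ha]
      refine (add _ _ (hterm a) (MDiffAlong.sum hφ s fun i _ ↦ hterm i)).trans ?_
      rw [ih, add_zero, smul _ _ (mdifferentiableAt_coeffAlong hφ hV a)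
        (mdifferentiableAt_sectionAlong_comp hφ ((contMDiffAt_coordField _ a).mdifferentiableAt
          (by simp)))]
      exact (congrArg _ (h0 _)).trans (smul_zero _)
  let ψ (z : M) : ℝ := if V z = S z then 1 else 0
  have hψx : ψ x = 1 := by simp only [ψ, if_pos hVS.self_of_nhds]
  have hψ : MDiffAt ψ x :=
    (mdifferentiableAt_const (c := (1 : ℝ))).congr_of_eventuallyEq
      (hVS.mono fun z hz ↦ by simp only [ψ, if_pos hz])
  have hψVS : (fun z ↦ ψ z • V z) = fun z ↦ ψ z • S z := by
    funext z
    by_cases hz : V z = S z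
    · rw [hz]
    · simp only [ψ, if_neg hz, zero_smul]
  have h1 := smul ψ V hψ hV
  have h2 := smul ψ S hψ (MDiffAlong.sum hφ _ fun a _ ↦ hterm a)
  rw [hψx, one_smul] at h1 h2
  rw [← h1, hψVS, h2]
  exact hsum _

end Along

section CovAlong

variable {E : Type*} [NormedAddCommGroup E] [NormedSpace ℝ E] [FiniteDimensional ℝ E]
  {H : Type*} [TopologicalSpace H] {I : ModelWithCorners ℝ E H}
  {M : Type*} [TopologicalSpace M] [ChartedSpace H M] [IsManifold I ∞ M]
  {F : Type*} [NormedAddCommGroup F] [NormedSpace ℝ F] [FiniteDimensional ℝ F]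
  {G : Type*} [TopologicalSpace G] {J : ModelWithCorners ℝ F G}
  {N : Type*} [TopologicalSpace N] [ChartedSpace G N] [IsManifold J ∞ N]
  [RiemannianBundle (fun y : N ↦ TangentSpace J y)]
  [IsContMDiffRiemannianBundle J ∞ F (fun y : N ↦ TangentSpace J y)]
  {φ : M → N} {V V' : Π z : M, TangentSpace J (φ z)} {x : M}

theorem leviCivita_extendField_add {y : N} (u v : TangentSpace J y) :
    leviCivita J N (extendField (u + v)) y =
      leviCivita J N (extendField u) y + leviCivita J N (extendField v) y := by
  rw [leviCivita_congr (mdifferentiableAt_extendField _) (extendField_add u v),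
    leviCivita_add (mdifferentiableAt_extendField u) (mdifferentiableAt_extendField v)]

theorem leviCivita_extendField_smul {y : N} (a : ℝ) (u : TangentSpace J y) :
    leviCivita J N (extendField (a • u)) y = a • leviCivita J N (extendField u) y := by
  rw [leviCivita_congr (mdifferentiableAt_extendField _) (extendField_smul a u),
    leviCivita_const_smul a (mdifferentiableAt_extendField u)]

theorem covAlong_apply (v : TangentSpace I x) :
    covAlong I J φ V x v =
      (trivializationAt F (TangentSpace J) (φ x)).symmL ℝ (φ x) (mvfderiv I (coordAlong φ V x) x v) +
      leviCivita J N (extendField (V x)) (φ x) (mfderiv I J φ x v) :=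
  rfl

theorem covAlong_congr (h : V =ᶠ[𝓝 x] V') : covAlong I J φ V x = covAlong I J φ V' x := by
  have hc : coordAlong φ V x =ᶠ[𝓝 x] coordAlong φ V' x := by
    filter_upwards [h] with z hz
    simp only [coordAlong, hz]
  ext v
  rw [covAlong_apply, covAlong_apply, hc.mvfderiv_eq, h.self_of_nhds]

theorem covAlong_add (hφ : MDiffAt φ x) (hV : MDiffAt (sectionAlong φ V) x)
    (hV' : MDiffAt (sectionAlong φ V') x) :
    covAlong I J φ (V + V') x = covAlong I J φ V x + covAlong I J φ V' x := by
  rw [mdifferentiableAt_sectionAlong_iff hφ] at hV hV'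
  ext v
  rw [covAlong_apply, (coordAlong_add hφ.continuousAt).mvfderiv_eq, mvfderiv_add hV hV',
    Pi.add_apply, leviCivita_extendField_add, add_apply, add_apply, add_apply, map_add,
    covAlong_apply, covAlong_apply]
  abel

theorem covAlong_smul (hφ : MDiffAt φ x) {f : M → ℝ} (hf : MDiffAt f x)
    (hV : MDiffAt (sectionAlong φ V) x) (v : TangentSpace I x) :
    covAlong I J φ (fun z ↦ f z • V z) x v =
      f x • covAlong I J φ V x v + mvfderiv I f x v • V x := by
  rw [mdifferentiableAt_sectionAlong_iff hφ] at hV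
  rw [covAlong_apply, (coordAlong_smul hφ.continuousAt f).mvfderiv_eq, mvfderiv_smul hf hV,
    leviCivita_extendField_smul, covAlong_apply]
  simp only [add_apply, smul_apply, ContinuousLinearMap.smulRight_apply, map_add, map_smul,
    symmL_coordAlong (mem_chart_source G (φ x)), smul_add]
  abel

theorem covAlong_sum (hφ : MDiffAt φ x) {ι : Type*} (s : Finset ι)
    {V : ι → Π z : M, TangentSpace J (φ z)} (hV : ∀ i ∈ s, MDiffAt (sectionAlong φ (V i)) x) :
    covAlong I J φ (fun z ↦ ∑ i ∈ s, V i z) x = ∑ i ∈ s, covAlong I J φ (V i) x := by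
  classical
  induction s using Finset.induction_on with
  | empty =>
    simp only [Finset.sum_empty]
    ext v
    have h := covAlong_smul (I := I) (J := J) hφ (f := fun _ ↦ 0) mdifferentiableAt_const
      (MDiffAlong.sum hφ (∅ : Finset ℕ) (V := fun _ z ↦ (0 : TangentSpace J (φ z))) (by simp)) v
    simpa using h
  | insert a s ha ih =>
    simp only [Finset.sum_insert ha]
    rw [← ih fun i hi ↦ hV i (by simp [hi])]
    exact covAlong_add hφ (hV a (by simp)) (MDiffAlong.sum hφ s fun i hi ↦ hV i (by simp [hi]))

theorem covAlong_extendField (hφ : MDiffAt φ x) (w : TangentSpace J (φ x)) :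
    covAlong I J φ (fun z ↦ extendField w (φ z)) x =
      leviCivita J N (extendField w) (φ x) ∘L mfderiv I J φ x := by
  ext v
  have h : mvfderiv I (coordAlong φ (fun z ↦ extendField w (φ z)) x) x = 0 :=
    (coordAlong_extendField hφ.continuousAt w).mvfderiv_eq.trans (mvfderiv_const (w : F))
  rw [covAlong_apply, h, zero_apply, map_zero, zero_add,
    show extendField w (φ x) = w from FiberBundle.extend_apply_self F w]
  rfl

/-- The induced connection on `φ⁻¹TN` restricts to the connection of `N` on vector fields
of `N`. -/
theorem covAlong_comp (hφ : MDiffAt φ x) {W : Π y : N, TangentSpace J y}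
    (hW : MDiffAt (T% W) (φ x)) :
    covAlong I J φ (fun z ↦ W (φ z)) x = leviCivita J N W (φ x) ∘L mfderiv I J φ x := by
  have hT : TensorialAt J F (fun W : Π y : N, TangentSpace J y ↦
      covAlong I J φ (fun z ↦ W (φ z)) x - leviCivita J N W (φ x) ∘L mfderiv I J φ x) (φ x) :=
    { smul := by
        intro f W hf hW
        ext v
        have h1 := covAlong_smul hφ (MDifferentiableAt.comp x hf hφ)
          (mdifferentiableAt_sectionAlong_comp hφ hW) v
        have h2 := leviCivita_smul hf hW (mfderiv I J φ x v)
        have h3 := mvfderiv_comp_apply x hf hφ v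
        simp only [Function.comp_apply] at h1
        rw [h3] at h1
        simp only [sub_apply, smul_apply, ContinuousLinearMap.comp_apply, Pi.smul_apply', h2]
        rw [h1, smul_sub]
        abel
      add := by
        intro W W' hW hW'
        have h1 := covAlong_add hφ (mdifferentiableAt_sectionAlong_comp hφ hW)
          (mdifferentiableAt_sectionAlong_comp hφ hW')
        have h2 := leviCivita_add hW hW'
        simp only [h2, ContinuousLinearMap.add_comp]
        refine (congrArg₂ (· - ·) h1 rfl).trans ?_
        abel }
  have h := hT.pointwise hW (mdifferentiableAt_extendField (W (φ x)))
    (FiberBundle.extend_apply_self F _).symm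
  simp only [covAlong_extendField hφ, sub_self] at h
  exact sub_eq_zero.1 h

theorem mdifferentiableAt_inner_along (hV : MDiffAt (sectionAlong φ V) x)
    (hV' : MDiffAt (sectionAlong φ V') x) : MDiffAt (fun z ↦ inner ℝ (V z) (V' z)) x :=
  MDifferentiableAt.inner_bundle (F := F) (E := fun y : N ↦ TangentSpace J y) hV hV'

/-- The induced connection on `φ⁻¹TN` is compatible with the metric. -/
theorem mvfderiv_inner_along (hφ : MDiffAt φ x) (hV : MDiffAt (sectionAlong φ V) x)
    (hV' : MDiffAt (sectionAlong φ V') x) (v : TangentSpace I x) :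
    mvfderiv I (fun z ↦ inner ℝ (V z) (V' z)) x v =
      inner ℝ (covAlong I J φ V x v) (V' x) + inner ℝ (V x) (covAlong I J φ V' x v) := by
  let Ψ (V V' : Π z : M, TangentSpace J (φ z)) : ℝ :=
    mvfderiv I (fun z ↦ inner ℝ (V z) (V' z)) x v -
      (inner ℝ (covAlong I J φ V x v) (V' x) + inner ℝ (V x) (covAlong I J φ V' x v))
  have symm (V V') : Ψ V V' = Ψ V' V := by
    simp only [Ψ]
    simp_rw [real_inner_comm]
    ring
  have smul (V' : Π z : M, TangentSpace J (φ z)) (hV' : MDiffAt (sectionAlong φ V') x)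
      (f : M → ℝ) (V) (hf : MDiffAt f x) (hV : MDiffAt (sectionAlong φ V) x) :
      Ψ (fun z ↦ f z • V z) V' = f x • Ψ V V' := by
    have h := mvfderiv_fun_mul hf (mdifferentiableAt_inner_along hV hV')
    simp only [Ψ, covAlong_smul hφ hf hV, real_inner_smul_left, h, inner_add_left, add_apply,
      smul_apply, smul_eq_mul]
    ring
  have add (V' : Π z : M, TangentSpace J (φ z)) (hV' : MDiffAt (sectionAlong φ V') x)
      (V₁ V₂) (h₁ : MDiffAt (sectionAlong φ V₁) x) (h₂ : MDiffAt (sectionAlong φ V₂) x) :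
      Ψ (V₁ + V₂) V' = Ψ V₁ V' + Ψ V₂ V' := by
    have h := mvfderiv_fun_add (mdifferentiableAt_inner_along h₁ hV')
      (mdifferentiableAt_inner_along h₂ hV')
    simp only [Ψ, covAlong_add hφ h₁ h₂, Pi.add_apply, h, inner_add_left, add_apply]
    ring
  have hext (w : TangentSpace J (φ x)) :
      MDiffAt (sectionAlong φ fun z ↦ extendField w (φ z)) x :=
    mdifferentiableAt_sectionAlong_comp hφ (mdifferentiableAt_extendField w)
  have base (w w' : TangentSpace J (φ x)) :
      Ψ (fun z ↦ extendField w (φ z)) (fun z ↦ extendField w' (φ z)) = 0 := by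
    have hw := mdifferentiableAt_extendField w
    have hw' := mdifferentiableAt_extendField w'
    have h := mvfderiv_comp_apply x (mdiffAt_inner hw hw') hφ v
    rw [mvfderiv_inner hw hw'] at h
    simp only [Ψ, covAlong_extendField hφ]
    exact sub_eq_zero.2 h
  have half (w' : TangentSpace J (φ x)) : Ψ V (fun z ↦ extendField w' (φ z)) = 0 :=
    tensorialAlong_eq_zero hφ (fun V ↦ Ψ V (fun z ↦ extendField w' (φ z)))
      (smul _ (hext w')) (add _ (hext w')) (fun w ↦ base w w') hV
  refine sub_eq_zero.1 ((symm V V').trans ?_)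
  exact tensorialAlong_eq_zero hφ (fun V' ↦ Ψ V' V) (smul V hV) (add V hV)
    (fun w ↦ (symm _ _).trans (half w)) hV'

theorem mdifferentiableAt_mfderiv_apply {X : Π z : M, TangentSpace I z}
    (hφ : CMDiffAt ∞ φ x) (hX : MDiffAt (T% X) x) :
    MDiffAt (sectionAlong φ fun z ↦ mfderiv I J φ z (X z)) x :=
  MDifferentiableAt.clm_apply_of_inCoordinates
    ((hφ.mfderiv_const (m := 1) (by norm_num; exact ENat.LEInfty.out)).mdifferentiableAt one_ne_zero)
    hX (hφ.mdifferentiableAt (by simp))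

theorem eventually_mdifferentiableAt_of_contMDiffAt {F' : Type*} [NormedAddCommGroup F']
    [NormedSpace ℝ F'] {G' : Type*} [TopologicalSpace G'] {J' : ModelWithCorners ℝ F' G'}
    {N' : Type*} [TopologicalSpace N'] [ChartedSpace G' N'] [IsManifold J' ∞ N'] {f : M → N'}
    (hf : CMDiffAt ∞ f x) : ∀ᶠ z in 𝓝 x, MDiffAt f z :=
  ((contMDiffAt_iff_contMDiffAt_nhds (by simp)).1 (hf.of_le (m := 1) (by simp))).mono
    fun _ h ↦ h.mdifferentiableAt one_ne_zero

/-- The induced covariant derivative of a smooth section along a smooth field is smooth. -/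
theorem contMDiffAt_covAlong {X : Π z : M, TangentSpace I z} (hφ : CMDiffAt ∞ φ x)
    (hX : CMDiffAt ∞ (T% X) x) (hV : CMDiffAt ∞ (sectionAlong φ V) x) :
    CMDiffAt ∞ (sectionAlong φ fun z ↦ covAlong I J φ V z (X z)) x := by
  let S := coordField J (φ x)
  have hS (a) : CMDiffAt ∞ (T% (S a)) (φ x) := contMDiffAt_coordField _ a
  let f := coeffAlong φ V x
  have hf (a) : CMDiffAt ∞ (f a) x := contMDiffAt_coeffAlong hφ hV a
  let dX : Π z : M, TangentSpace J (φ z) := fun z ↦ mfderiv I J φ z (X z)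
  let h := coeffAlong φ dX x
  have hh (c) : CMDiffAt ∞ (h c) x :=
    contMDiffAt_coeffAlong hφ (contMDiffAt_mfderiv_apply hφ hX) c
  have hsm : CMDiffAt ∞ (sectionAlong φ fun z ↦ ∑ a,
      ((fun z ↦ f a z • ∑ c, h c z • leviCivita J N (S a) (φ z) (S c (φ z))) +
        fun z ↦ mvfderiv I (f a) z (X z) • S a (φ z)) z) x := by
    refine CMDiffAlong.sum hφ _ fun a _ ↦ CMDiffAlong.add hφ (CMDiffAlong.smul hφ (hf a)
      (CMDiffAlong.sum hφ _ fun c _ ↦ CMDiffAlong.smul hφ (hh c) ?_))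
      (CMDiffAlong.smul hφ (contMDiffAt_mvfderiv_apply (hf a) hX)
        (contMDiffAt_sectionAlong_comp hφ (hS a)))
    exact contMDiffAt_sectionAlong_comp
      (W := fun y ↦ leviCivita J N (S a) y (S c y)) hφ (contMDiffAt_leviCivita (hS c) (hS a))
  refine hsm.congr_of_eventuallyEq ?_
  filter_upwards [eventually_mdifferentiableAt_of_contMDiffAt hφ,
    eventually_all.2 fun a ↦ eventually_mdifferentiableAt_of_contMDiffAt (hf a),
    eventually_all.2 fun a ↦ hφ.continuousAt.eventually (eventually_mdifferentiableAt (hS a)),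
    (eventually_mem_chart_source (G := G) hφ.continuousAt).eventually_nhds] with z hz hfz hSz hcz
  refine congrArg (TotalSpace.mk' F (φ z)) ?_
  let W : Π z : M, TangentSpace J (φ z) := fun z ↦ ∑ a, f a z • S a (φ z)
  have hVS : V =ᶠ[𝓝 z] W :=
    hcz.mono fun z' hz' ↦ eq_sum_coordField hz'
  have hSφ (a) := mdifferentiableAt_sectionAlong_comp hz (hSz a)
  have hsum := covAlong_sum (I := I) hz Finset.univ
    fun a _ ↦ MDiffAlong.smul hz (hfz a) (hSφ a)
  beta_reduce
  rw [covAlong_congr hVS, show covAlong I J φ W z = _ from hsum, sum_apply]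
  refine Finset.sum_congr rfl fun a _ ↦ ?_
  have hdX : mfderiv I J φ z (X z) = ∑ c, h c z • S c (φ z) :=
    eq_sum_coordField (V := dX) hcz.self_of_nhds
  rw [covAlong_smul hz (hfz a) (hSφ a), covAlong_comp hz (hSz a),
    ContinuousLinearMap.comp_apply, hdX, map_sum]
  simp only [map_smul]
  rfl

end CovAlong

/-- The trace of a bilinear map does not depend on the orthonormal basis. -/
theorem sum_orthonormalBasis_eq {T A ι κ : Type*} [NormedAddCommGroup T] [InnerProductSpace ℝ T]
    [AddCommGroup A] [Module ℝ A] [Fintype ι] [Fintype κ] (b : OrthonormalBasis ι ℝ T)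
    (b' : OrthonormalBasis κ ℝ T) (B : T → T → A)
    (add_left : ∀ u u' v, B (u + u') v = B u v + B u' v)
    (smul_left : ∀ (a : ℝ) u v, B (a • u) v = a • B u v)
    (add_right : ∀ u v v', B u (v + v') = B u v + B u v')
    (smul_right : ∀ (a : ℝ) u v, B u (a • v) = a • B u v) :
    ∑ i, B (b i) (b i) = ∑ j, B (b' j) (b' j) := by
  let L : T →ₗ[ℝ] T →ₗ[ℝ] A := LinearMap.mk₂ ℝ B add_left smul_left add_right smul_right
  change ∑ i, L (b i) (b i) = ∑ j, L (b' j) (b' j)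
  have h1 (i) : L (b i) (b i) = ∑ j, inner ℝ (b' j) (b i) • L (b i) (b' j) := by
    conv_lhs => rw [← b'.sum_repr' (b i)]
    rw [map_sum]
    conv_lhs => rw [b'.sum_repr' (b i)]
    simp only [map_smul]
  have h2 (j) : L (b' j) (b' j) = ∑ i, inner ℝ (b i) (b' j) • L (b i) (b' j) := by
    conv_lhs => enter [1]; rw [← b.sum_repr' (b' j)]
    simp only [map_sum, map_smul, LinearMap.sum_apply, LinearMap.smul_apply]
  simp only [h1, h2]
  rw [Finset.sum_comm]
  simp only [real_inner_comm]

section Immersion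

variable {E : Type*} [NormedAddCommGroup E] [NormedSpace ℝ E] [FiniteDimensional ℝ E]
  {H : Type*} [TopologicalSpace H] {I : ModelWithCorners ℝ E H}
  {M : Type*} [TopologicalSpace M] [ChartedSpace H M] [IsManifold I ∞ M]
  [RiemannianBundle (fun x : M ↦ TangentSpace I x)]
  [IsContMDiffRiemannianBundle I ∞ E (fun x : M ↦ TangentSpace I x)]
  {F : Type*} [NormedAddCommGroup F] [NormedSpace ℝ F] [FiniteDimensional ℝ F]
  {G : Type*} [TopologicalSpace G] {J : ModelWithCorners ℝ F G}
  {N : Type*} [TopologicalSpace N] [ChartedSpace G N] [IsManifold J ∞ N]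
  [RiemannianBundle (fun y : N ↦ TangentSpace J y)]
  [IsContMDiffRiemannianBundle J ∞ F (fun y : N ↦ TangentSpace J y)]
  {φ : M → N} {x : M}

theorem tensorialAt_secondFundamentalForm (hφ : CMDiffAt ∞ φ x) :
    TensorialAt I E (fun Y : Π z : M, TangentSpace I z ↦
      covAlong I J φ (fun z ↦ mfderiv I J φ z (Y z)) x -
        mfderiv I J φ x ∘L leviCivita I M Y x) x where
  smul := by
    intro f Y hf hY
    ext v
    have hφ' := hφ.mdifferentiableAt (n := ∞) (by simp)
    have h1 := covAlong_smul hφ' hf (mdifferentiableAt_mfderiv_apply hφ hY) v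
    have h2 := leviCivita_smul hf hY v
    simp only [sub_apply, smul_apply, ContinuousLinearMap.comp_apply, Pi.smul_apply', map_smul,
      h2, h1, map_add, smul_sub]
    abel
  add := by
    intro Y Y' hY hY'
    ext v
    have hφ' := hφ.mdifferentiableAt (n := ∞) (by simp)
    have h1 := congr($(covAlong_add hφ' (mdifferentiableAt_mfderiv_apply hφ hY)
      (mdifferentiableAt_mfderiv_apply hφ hY')) v)
    have h2 := leviCivita_add hY hY'
    have h3 : (fun z ↦ mfderiv I J φ z ((Y + Y') z)) =
        (fun z ↦ mfderiv I J φ z (Y z)) + fun z ↦ mfderiv I J φ z (Y' z) :=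
      funext fun z ↦ map_add _ _ _
    simp only [sub_apply, add_apply, ContinuousLinearMap.comp_apply, h3, h2, map_add]
    rw [h1, add_apply]
    abel

theorem secondFundamentalForm_eq {Y : Π z : M, TangentSpace I z} (hφ : CMDiffAt ∞ φ x)
    (hY : MDiffAt (T% Y) x) (u : TangentSpace I x) :
    secondFundamentalForm I J φ x u (Y x) =
      covAlong I J φ (fun z ↦ mfderiv I J φ z (Y z)) x u -
        mfderiv I J φ x (leviCivita I M Y x u) :=
  congr($((tensorialAt_secondFundamentalForm hφ).pointwise
    (mdifferentiableAt_extendField (Y x)) hY (FiberBundle.extend_apply_self E _)) u)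

theorem secondFundamentalForm_add_left (u u' v : TangentSpace I x) :
    secondFundamentalForm I J φ x (u + u') v =
      secondFundamentalForm I J φ x u v + secondFundamentalForm I J φ x u' v := by
  simp only [secondFundamentalForm, map_add]
  abel

theorem secondFundamentalForm_smul_left (a : ℝ) (u v : TangentSpace I x) :
    secondFundamentalForm I J φ x (a • u) v = a • secondFundamentalForm I J φ x u v := by
  simp only [secondFundamentalForm, map_smul, smul_sub]

theorem leviCivita_extendField_comm {y : N} (a b : TangentSpace J y) :
    leviCivita J N (extendField b) y a = leviCivita J N (extendField a) y b := by
  have h : covExtend a b y = covExtend b a y := (covExtend_comm a b).self_of_nhds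
  simpa [covExtend] using h

/-- The second fundamental form is symmetric. -/
theorem secondFundamentalForm_comm [I.Boundaryless] (hφ : CMDiffAt ∞ φ x)
    (u v : TangentSpace I x) :
    secondFundamentalForm I J φ x u v = secondFundamentalForm I J φ x v u := by
  have hf : CMDiffAt ∞ (extChartAt J (φ x) ∘ φ) x :=
    (contMDiffAt_extChartAt (x := φ x)).comp x hφ
  have key (w : TangentSpace I x) :
      coordAlong φ (fun z ↦ mfderiv I J φ z (extendField w z)) x =ᶠ[𝓝 x]
        fun z ↦ mvfderiv I (extChartAt J (φ x) ∘ φ) z (extendField w z) := by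
    filter_upwards [eventually_mdifferentiableAt_of_contMDiffAt hφ,
      eventually_mem_chart_source (G := G) hφ.continuousAt] with z hz hzs
    rw [coordAlong_apply hzs]
    exact (mfderiv_comp_apply z (mdifferentiableAt_extChartAt hzs) hz (extendField w z)).symm
  have hcomm := mvfderiv_mvfderiv_extend_comm hf u v
  have expand (u v : TangentSpace I x) : secondFundamentalForm I J φ x u v =
      (trivializationAt F (TangentSpace J) (φ x)).symmL ℝ (φ x)
        (mvfderiv I (fun z ↦ mvfderiv I (extChartAt J (φ x) ∘ φ) z (extendField v z)) x u) +
      leviCivita J N (extendField (mfderiv I J φ x v)) (φ x) (mfderiv I J φ x u) -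
      mfderiv I J φ x (leviCivita I M (extendField v) x u) := by
    have hv : extendField v x = v := FiberBundle.extend_apply_self E v
    have h := covAlong_apply (J := J) (V := fun z ↦ mfderiv I J φ z (extendField v z)) u
    rw [(key v).mvfderiv_eq] at h
    rw [hv] at h
    exact congrArg (· - mfderiv I J φ x (leviCivita I M (extendField v) x u)) h
  rw [expand, expand, hcomm, leviCivita_extendField_comm u v,
    leviCivita_extendField_comm (mfderiv I J φ x u)]

theorem secondFundamentalForm_add_right [I.Boundaryless] (hφ : CMDiffAt ∞ φ x)
    (u v v' : TangentSpace I x) : secondFundamentalForm I J φ x u (v + v') =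
      secondFundamentalForm I J φ x u v + secondFundamentalForm I J φ x u v' := by
  simp only [secondFundamentalForm_comm hφ u, secondFundamentalForm_add_left]

theorem secondFundamentalForm_smul_right [I.Boundaryless] (hφ : CMDiffAt ∞ φ x) (a : ℝ)
    (u v : TangentSpace I x) : secondFundamentalForm I J φ x u (a • v) =
      a • secondFundamentalForm I J φ x u v := by
  simp only [secondFundamentalForm_comm hφ u, secondFundamentalForm_smul_left]

theorem tension_eq_sum [I.Boundaryless] (hφ : CMDiffAt ∞ φ x) {ι : Type*} [Fintype ι]
    (b : OrthonormalBasis ι ℝ (TangentSpace I x)) :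
    tension I J φ x = ∑ i, secondFundamentalForm I J φ x (b i) (b i) :=
  sum_orthonormalBasis_eq _ b _ secondFundamentalForm_add_left secondFundamentalForm_smul_left
    (secondFundamentalForm_add_right hφ) (secondFundamentalForm_smul_right hφ)

/-- The tension field of a smooth map is smooth. -/
theorem contMDiffAt_tension [I.Boundaryless] (hφ : CMDiff ∞ φ) :
    CMDiffAt ∞ (sectionAlong φ (tension I J φ)) x := by
  obtain ⟨e, he, hb⟩ := exists_contMDiffAt_orthonormalBasis (I := I) x
  have hsm : CMDiffAt ∞ (sectionAlong φ fun z ↦ ∑ i,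
      ((fun z ↦ covAlong I J φ (fun z ↦ mfderiv I J φ z (e i z)) z (e i z)) +
        fun z ↦ (-1 : ℝ) • mfderiv I J φ z (leviCivita I M (e i) z (e i z))) z) x := by
    refine CMDiffAlong.sum hφ.contMDiffAt _ fun i _ ↦ CMDiffAlong.add hφ.contMDiffAt
      (contMDiffAt_covAlong hφ.contMDiffAt (he i)
        (contMDiffAt_mfderiv_apply hφ.contMDiffAt (he i)))
      (CMDiffAlong.smul hφ.contMDiffAt contMDiffAt_const ?_)
    exact contMDiffAt_mfderiv_apply hφ.contMDiffAt (contMDiffAt_leviCivita (he i) (he i))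
  refine hsm.congr_of_eventuallyEq ?_
  filter_upwards [hb, eventually_all.2 fun i ↦ eventually_mdifferentiableAt (he i)]
    with z ⟨b, hbz⟩ hez
  refine congrArg (TotalSpace.mk' F (φ z)) ?_
  rw [tension_eq_sum hφ.contMDiffAt b]
  refine Finset.sum_congr rfl fun i _ ↦ ?_
  rw [hbz i, secondFundamentalForm_eq hφ.contMDiffAt (hez i), Pi.add_apply, neg_one_smul,
    sub_eq_add_neg]

/-- The second fundamental form of an isometric immersion is normal. -/
theorem IsIsometricImmersion.inner_secondFundamentalForm [I.Boundaryless]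
    (hφ : IsIsometricImmersion I J φ) (u v w : TangentSpace I x) :
    inner ℝ (secondFundamentalForm I J φ x u v) (mfderiv I J φ x w) = 0 := by
  have hs : CMDiffAt ∞ φ x := hφ.smooth.contMDiffAt
  have skew (u v w : TangentSpace I x) :
      inner ℝ (secondFundamentalForm I J φ x u v) (mfderiv I J φ x w) =
        -inner ℝ (secondFundamentalForm I J φ x u w) (mfderiv I J φ x v) := by
    have hv := mdifferentiableAt_extendField v
    have hw := mdifferentiableAt_extendField w
    have h1 := mvfderiv_inner_along (hs.mdifferentiableAt (by simp))
      (mdifferentiableAt_mfderiv_apply hs hv) (mdifferentiableAt_mfderiv_apply hs hw) u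
    simp only [hφ.inner_eq] at h1
    rw [mvfderiv_inner hv hw, ← hφ.inner_eq, ← hφ.inner_eq] at h1
    have ev : extendField v x = v := FiberBundle.extend_apply_self E v
    have ew : extendField w x = w := FiberBundle.extend_apply_self E w
    rw [ev, ew] at h1
    simp only [secondFundamentalForm, inner_sub_left]
    rw [real_inner_comm _ (mfderiv I J φ x v), real_inner_comm _ (mfderiv I J φ x v)] at h1
    linarith
  have comm := secondFundamentalForm_comm (I := I) (J := J) hs
  have h1 := skew u v w
  have h2 := skew v w u
  have h3 := skew w u v
  rw [comm v u] at h2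
  rw [comm w u, comm w v] at h3
  linarith

theorem IsIsometricImmersion.inner_tension [I.Boundaryless]
    (hφ : IsIsometricImmersion I J φ) (w : TangentSpace I x) :
    inner ℝ (tension I J φ x) (mfderiv I J φ x w) = 0 := by
  simp only [tension, sum_inner, hφ.inner_secondFundamentalForm, Finset.sum_const_zero]

theorem IsIsometricImmersion.inner_covAlong_tension [I.Boundaryless]
    (hφ : IsIsometricImmersion I J φ) (u : TangentSpace I x) :
    inner ℝ (covAlong I J φ (tension I J φ) x u) (mfderiv I J φ x u) =
      -inner ℝ (tension I J φ x) (secondFundamentalForm I J φ x u u) := by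
  have hs : CMDiffAt ∞ φ x := hφ.smooth.contMDiffAt
  have hu := mdifferentiableAt_extendField u
  have h := mvfderiv_inner_along (hs.mdifferentiableAt (by simp))
    ((contMDiffAt_tension hφ.smooth).mdifferentiableAt (by simp))
    (mdifferentiableAt_mfderiv_apply hs hu) u
  simp only [hφ.inner_tension, mvfderiv_const, zero_apply] at h
  have eu : extendField u x = u := FiberBundle.extend_apply_self E u
  rw [eu] at h
  simp only [secondFundamentalForm, inner_sub_right, hφ.inner_tension]
  linarith

/-- In a space of constant curvature the trace `∑ R(w, dφ(e_i))dφ(e_i)` does not depend on the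
orthonormal basis. -/
theorem HasConstantCurvature.sum_curvature_eq [J.Boundaryless] {c : ℝ}
    (hN : HasConstantCurvature J N c) (w : TangentSpace J (φ x)) {ι κ : Type*} [Fintype ι]
    [Fintype κ] (b : OrthonormalBasis ι ℝ (TangentSpace I x))
    (b' : OrthonormalBasis κ ℝ (TangentSpace I x)) :
    ∑ i, curvature J w (mfderiv I J φ x (b i)) (mfderiv I J φ x (b i)) =
      ∑ j, curvature J w (mfderiv I J φ x (b' j)) (mfderiv I J φ x (b' j)) := by
  refine sum_orthonormalBasis_eq b b'
    (fun u v ↦ curvature J w (mfderiv I J φ x u) (mfderiv I J φ x v)) ?_ ?_ ?_ ?_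
  all_goals
    intros
    simp only [hN.curvature_eq, map_add, map_smul, inner_add_left, inner_add_right,
      real_inner_smul_left, real_inner_smul_right]
    module

/-- For an isometric immersion into a space of constant curvature,
`∑ R(∇̄_{e_i} τ, τ)dφ(e_i) = c |τ|² τ`. -/
theorem IsIsometricImmersion.sum_curvature_covAlong_tension [I.Boundaryless] [J.Boundaryless]
    (hφ : IsIsometricImmersion I J φ) {c : ℝ} (hN : HasConstantCurvature J N c) {ι : Type*}
    [Fintype ι] (b : OrthonormalBasis ι ℝ (TangentSpace I x)) :
    ∑ i, curvature J (covAlong I J φ (tension I J φ) x (b i)) (tension I J φ x)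
        (mfderiv I J φ x (b i)) =
      (c * inner ℝ (tension I J φ x) (tension I J φ x)) • tension I J φ x := by
  have hsum : ∑ i, inner ℝ (tension I J φ x) (secondFundamentalForm I J φ x (b i) (b i)) =
      inner ℝ (tension I J φ x) (tension I J φ x) := by
    rw [← inner_sum, ← tension_eq_sum hφ.smooth.contMDiffAt b]
  simp only [hN.curvature_eq, hφ.inner_tension, hφ.inner_covAlong_tension, zero_smul, zero_sub,
    neg_smul, neg_neg, smul_smul]
  rw [← Finset.sum_smul, ← Finset.mul_sum, hsum]

end Immersion

end RiemGeom

theorem corollary2p3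
    {E : Type*} [NormedAddCommGroup E] [NormedSpace ℝ E] [FiniteDimensional ℝ E]
    {H : Type*} [TopologicalSpace H] (I : ModelWithCorners ℝ E H) [I.Boundaryless]
    {M : Type*} [TopologicalSpace M] [ChartedSpace H M] [IsManifold I ∞ M]
    [RiemannianBundle (fun x : M ↦ TangentSpace I x)]
    [IsContMDiffRiemannianBundle I ∞ E (fun x : M ↦ TangentSpace I x)]
    {F : Type*} [NormedAddCommGroup F] [NormedSpace ℝ F] [FiniteDimensional ℝ F]
    {G : Type*} [TopologicalSpace G] (J : ModelWithCorners ℝ F G) [J.Boundaryless]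
    {N : Type*} [TopologicalSpace N] [ChartedSpace G N] [IsManifold J ∞ N]
    [RiemannianBundle (fun y : N ↦ TangentSpace J y)]
    [IsContMDiffRiemannianBundle J ∞ F (fun y : N ↦ TangentSpace J y)]
    (c : ℝ) (hN : HasConstantCurvature J N c)
    (φ : M → N) (hφ : IsIsometricImmersion I J φ)
    (x : M) {ι : Type*} [Fintype ι] (e : OrthonormalBasis ι ℝ (TangentSpace I x)) :
    tritension I J φ x =
      roughLaplacian I J φ (roughLaplacian I J φ (tension I J φ)) x
        - ∑ j, curvature J (roughLaplacian I J φ (tension I J φ) x)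
            (mfderiv I J φ x (e j)) (mfderiv I J φ x (e j))
        - (c * inner ℝ (tension I J φ x) (tension I J φ x)) • tension I J φ x := by
  rw [← hφ.sum_curvature_covAlong_tension hN (stdOrthonormalBasis ℝ (TangentSpace I x)),
    hN.sum_curvature_eq _ e (stdOrthonormalBasis ℝ (TangentSpace I x))]
  rfl
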